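/- Let $\gamma\ge 1$ and $m\ge 0$ be integers, $N=\mathbb R^\gamma$, and let $Z\subseteq\mathbb R^m$ be an open set containing $0$. Consider the single-input system in actuation-decomposition form on $N\times Z$, with state $\zeta=(\eta,z)$ and input $u\in\mathbb R$, $$\dot\eta = F\eta+Gu,\qquad \dot z=\omega(\eta,z),$$ where $F\eta=(\eta_2,\dots,\eta_\gamma,0)$, $G=(0,\dots,0,1)^\top$, i.e. $\dot\zeta=f(\zeta)+g(\zeta)u$ with $f=(F\eta,\omega)$, $g=(G,0)$. Assume that $\omega:N\times Z\to\mathbb R^m$ is of class $C^{\max\{1,\gamma-1\}}$, that $\omega(0,0)=0$, that $\partial\omega/\partial\eta_i\equiv 0$ for $i=3,\dots,\gamma$, and that the system is (linearly) locally controllable at the origin: with $A=\frac{\partial f}{\partial\zeta}(0)$ and $B=g(0)$, the vectors $B,AB,\dots,A^{n-1}B$ span $\mathbb R^n$, $n=\gamma+m$. Then there are a linear feedback $u=-K\zeta$ for which $\dot\zeta=(A-BK)\zeta$ is exponentially stable and an $m$-dimensional $(A-BK)$-invariant subspace $\mathcal S\subset\mathbb R^n$ such that for each $z\in\mathbb R^m$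 there is a unique $\eta$ with $(\eta,z)\in\mathcal S$. For every such pair $(K,\mathcal S)$ there is a unique $s_{\eta_1}\in\mathbb R^m$ with $\eta_1=s_{\eta_1}^\top z$ for all $(\eta,z)\in\mathcal S$, and the output $y=\eta_1-s_{\eta_1}^\top z$, with error coordinates $e=(y,L_fy,\dots,L_f^{\gamma-1}y)$, has the following properties. 1. $y$ has relative degree $\gamma$ at every point of some neighborhood of the origin: $L_gL_f^ky\equiv0$ on $N\times Z$ for $0\le k\le\gamma-2$, and $L_gL_f^{\gamma-1}y\neq0$ near the origin. 2. There exist an open neighborhood $W\subseteq Z$ of $0$ and a $C^1$ map $\psi:W\to N$ (a zero dynamics policy) with $\psi(0)=0$ and $\psi_1(z)=s_{\eta_1}^\top z$ such that $e(\psi(z),z)=0$ for all $z\in W$; every $\zeta=(\eta,z)$ close enough to the origin with $e(\zeta)=0$ satisfies $\eta=\psi(z)$; the manifold $\mathcal M_\psi=\{(\psi(z),z):z\in W\}$ is controlled invariant (at each of its points some input makes $f+gu$ tangent to it); and the origin is a locally exponentially stable equilibrium of the zero dynamics $\dot z=\omega(\psi(z),z)$. 3. Exponentially stabilizing $e$ to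 $0$ stabilizes the whole system near the origin. Call a feedback $u=k(\zeta)$ output stabilizing if, in some neighborhood of the origin, either (a) $\frac{d}{dt}V(e)\le-k_3V(e)$ along the closed loop for some differentiable $V:\mathbb R^\gamma\to\mathbb R$ with $k_1\|a\|^2\le V(a)\le k_2\|a\|^2$ for all $a$ and constants $k_1,k_2,k_3>0$, or (b) for some $M,\lambda>0$, $\|e(t)\|\le Me^{-\lambda t}\|e(0)\|$ along every closed-loop solution as long as it stays in that neighborhood. Then for every output stabilizing $k$ there are $\delta,M',\lambda'>0$ such that every closed-loop solution in $N\times Z$ with $\|\zeta(0)\|<\delta$ satisfies $\|\zeta(t)\|\le M'e^{-\lambda't}\|\zeta(0)\|$ for as long as it exists; if moreover $k$ is Lipschitz in a neighborhood of the origin, then from every initial state close enough to the origin there is a closed-loop solution for all $t\ge0$. Furthermore, there is a $k$ of type (a), continuous in a neighborhood of the origin with $k(0)=0$, for which both the decay estimate and the existence of solutions for all $t\ge0$ hold. -/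

import Mathlib

open Set Filter Topology

noncomputable section

/-! ### Vector fields, solutions, exponential stability -/

section General

variable {E : Type*} [NormedAddCommGroup E] [NormedSpace ℝ E]

/-- The Lie derivative `L_X h` of the function `h` along the vector field `X`. -/
def lieDeriv (X : E → E) (h : E → ℝ) : E → ℝ := fun x => fderiv ℝ h x (X x)

/-- The iterated Lie derivative `L_X^k h`. -/
def lieDerivIter (X : E → E) (k : ℕ) (h : E → ℝ) : E → ℝ := (lieDeriv X)^[k] h

/-- The output `y` of `x' = f x + u • g x` (a system on the domain `D`) has relative degree `r` at
`x₀`: `L_g L_f^k y` vanishes identically on `D` for `0 ≤ k ≤ r - 2`,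
and `L_g L_f^(r-1) y` does not vanish at `x₀`. -/
def HasRelativeDegreeAt (f g : E → E) (D : Set E) (y : E → ℝ) (r : ℕ) (x₀ : E) : Prop :=
  1 ≤ r ∧
  (∀ k : ℕ, k + 2 ≤ r → ∀ x ∈ D, lieDeriv g (lieDerivIter f k y) x = 0) ∧
  lieDeriv g (lieDerivIter f (r - 1) y) x₀ ≠ 0

/-- `x` solves `x' = X x` on the time interval `I` and stays in `D`. -/
def IsSolutionOn (X : E → E) (D : Set E) (I : Set ℝ) (x : ℝ → E) : Prop :=
  ∀ t ∈ I, x t ∈ D ∧ HasDerivWithinAt x (X (x t)) I t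

/-- All solutions of `x' = X x` in `D` that start near the origin satisfy
`‖x t‖ ≤ M e^{-λ t} ‖x 0‖` for as long as they exist. -/
def HasExpDecay (X : E → E) (D : Set E) : Prop :=
  ∃ δ > (0 : ℝ), ∃ M > (0 : ℝ), ∃ lam > (0 : ℝ),
    ∀ T > (0 : ℝ), ∀ x : ℝ → E, IsSolutionOn X D (Ico 0 T) x → ‖x 0‖ < δ →
      ∀ t ∈ Ico (0 : ℝ) T, ‖x t‖ ≤ M * Real.exp (-lam * t) * ‖x 0‖

/-- From every point near the origin there starts a solution of `x' = X x` in `D` that is defined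
for all `t ≥ 0`. -/
def HasGlobalSolutions (X : E → E) (D : Set E) : Prop :=
  ∃ δ > (0 : ℝ), ∀ x₀ : E, ‖x₀‖ < δ → ∃ x : ℝ → E, x 0 = x₀ ∧ IsSolutionOn X D (Ici 0) x

/-- The origin is a (locally) exponentially stable equilibrium of `x' = X x` on `D`. -/
def IsExpStable (X : E → E) (D : Set E) : Prop :=
  HasGlobalSolutions X D ∧ HasExpDecay X D

/-- The vector field of `x' = f x + u • g x` under the state feedback `u = k x`. -/
def closedLoop (f g : E → E) (k : E → ℝ) : E → E := fun x => f x + k x • g x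

/-- The pair `(A, b)` is controllable: the columns `b, A b, …, A^(n-1) b` of the controllability
matrix span the `n`-dimensional state space. -/
def IsControllablePair (A : E →L[ℝ] E) (b : E) : Prop :=
  Submodule.span ℝ {v : E | ∃ k < Module.finrank ℝ E, v = (A ^ k) b} = ⊤

/-- The level set `{x ∈ D | h x = 0}` is controlled invariant under `x' = f x + u • g x`: at each of
its points some input makes the vector field tangent to it. -/
def IsControlledInvariant {F : Type*} [NormedAddCommGroup F] [NormedSpace ℝ F]
    (f g : E → E) (h : E → F) (D : Set E) : Prop :=
  ∀ x ∈ D, h x = 0 → ∃ u : ℝ, fderiv ℝ h x (f x + u • g x) = 0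

/-- The set `𝒦` of feedback controllers that stabilize the error `e` exponentially near the origin
in the sense of Lyapunov: for a function `V` of the error with quadratic bounds,
`d/dt V(e) ≤ -k₃ V(e)` along the closed loop. -/
def IsLyapunovOutputStabilizing {F : Type*} [NormedAddCommGroup F] [NormedSpace ℝ F]
    (f g : E → E) (e : E → F) (k : E → ℝ) : Prop :=
  ∃ V : F → ℝ, Differentiable ℝ V ∧
    ∃ k₁ > (0 : ℝ), ∃ k₂ > (0 : ℝ), ∃ k₃ > (0 : ℝ),
      (∀ a : F, k₁ * ‖a‖ ^ 2 ≤ V a ∧ V a ≤ k₂ * ‖a‖ ^ 2) ∧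
      ∀ᶠ x in 𝓝 (0 : E), lieDeriv (closedLoop f g k) (fun x' => V (e x')) x ≤ -k₃ * V (e x)

/-- The feedback `k` makes the error signal `e` exponentially stable near the origin:
`‖e(t)‖ ≤ M e^{-λ t} ‖e(0)‖` along every closed-loop solution, as long as that solution stays in a
certain neighborhood of the origin. -/
def IsOutputStabilizing {F : Type*} [NormedAddCommGroup F]
    (f g : E → E) (D : Set E) (e : E → F) (k : E → ℝ) : Prop :=
  ∃ U ∈ 𝓝 (0 : E), ∃ M > (0 : ℝ), ∃ lam > (0 : ℝ),
    ∀ T > (0 : ℝ), ∀ x : ℝ → E, IsSolutionOn (closedLoop f g k) (D ∩ U) (Ico 0 T) x →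
      ∀ t ∈ Ico (0 : ℝ) T, ‖e (x t)‖ ≤ M * Real.exp (-lam * t) * ‖e (x 0)‖

end General

/-! ### The system in actuation-decomposition form -/

/-- The space of the actuated coordinates `η = (η₁, …, η_γ)`; `η₁` is the entry with index `0`. -/
abbrev ActuatedSpace (γ : ℕ) : Type := EuclideanSpace ℝ (Fin γ)

/-- The space of the unactuated coordinates `z`. -/
abbrev UnactuatedSpace (m : ℕ) : Type := EuclideanSpace ℝ (Fin m)

/-- The space of the full state `ζ = (η, z)`. -/
abbrev FullSpace (γ m : ℕ) : Type := ActuatedSpace γ × UnactuatedSpace m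

/-- `F η = (η₂, …, η_γ, 0)`. -/
def chainF (γ : ℕ) (η : ActuatedSpace γ) : ActuatedSpace γ :=
  WithLp.toLp 2 fun i => if h : i.val + 1 < γ then η ⟨i.val + 1, h⟩ else 0

/-- `G = (0, …, 0, 1)`. -/
def chainG (γ : ℕ) : ActuatedSpace γ :=
  WithLp.toLp 2 fun i => if i.val + 1 = γ then 1 else 0

/-- `f(ζ) = (F η, ω(η, z))`. -/
def driftField {γ m : ℕ} (ω : FullSpace γ m → UnactuatedSpace m) :
    FullSpace γ m → FullSpace γ m :=
  fun ζ => (chainF γ ζ.1, ω ζ)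

/-- `g(ζ) = (G, 0)`. -/
def inputField (γ m : ℕ) : FullSpace γ m → FullSpace γ m := fun _ => (chainG γ, 0)

/-- The matrix `A` of the linearization at the origin: the Jacobian of the drift. -/
def linA {γ m : ℕ} (ω : FullSpace γ m → UnactuatedSpace m) :
    FullSpace γ m →L[ℝ] FullSpace γ m :=
  fderiv ℝ (driftField ω) 0

/-- The input vector `B` of the linearization at the origin. -/
def linB (γ m : ℕ) : FullSpace γ m := inputField γ m 0

/-- The feedback `u = -K ζ` stabilizes the linearization, and `S` is an `m`-dimensional subspace,
invariant under the closed-loop matrix `A - B K`, such that for each `z` there is a unique `η` with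
`(η, z) ∈ S`. -/
structure IsStabilizedInvariantSubspace {γ m : ℕ} (ω : FullSpace γ m → UnactuatedSpace m)
    (K : FullSpace γ m →L[ℝ] ℝ) (S : Submodule ℝ (FullSpace γ m)) : Prop where
  stable : IsExpStable (fun ζ => linA ω ζ - K ζ • linB γ m) univ
  invariant : ∀ ζ ∈ S, linA ω ζ - K ζ • linB γ m ∈ S
  finrank_eq : Module.finrank ℝ S = m
  graph : ∀ z : UnactuatedSpace m, ∃! η : ActuatedSpace γ, (η, z) ∈ S

/-- The output `y = η₁ - sᵀ z`. -/
def designedOutput {γ m : ℕ} [NeZero γ] (s : UnactuatedSpace m) : FullSpace γ m → ℝ :=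
  fun ζ => ζ.1 0 - inner ℝ s ζ.2

/-- The error coordinates `e = (y, L_f y, …, L_f^(γ-1) y)` of the output `y = η₁ - sᵀ z`. -/
def errorCoords {γ m : ℕ} [NeZero γ] (ω : FullSpace γ m → UnactuatedSpace m)
    (s : UnactuatedSpace m) : FullSpace γ m → ActuatedSpace γ :=
  fun ζ => WithLp.toLp 2 fun i => lieDerivIter (driftField ω) i.val (designedOutput s) ζ

/-- `ψ`, on the neighborhood `W` of the origin in `Z`, is a zero dynamics policy for the output
`y = η₁ - sᵀ z` with error coordinates `e`: the graph `η = ψ(z)` is, near the origin, the zeroing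
manifold `e = 0`, it is controlled invariant, and its zero dynamics `z' = ω(ψ(z), z)` are
exponentially stable. -/
structure IsLocalZeroDynamicsPolicy {γ m : ℕ} [NeZero γ] (Z : Set (UnactuatedSpace m))
    (ω : FullSpace γ m → UnactuatedSpace m) (s : UnactuatedSpace m)
    (W : Set (UnactuatedSpace m)) (ψ : UnactuatedSpace m → ActuatedSpace γ) : Prop where
  isOpen : IsOpen W
  zero_mem : (0 : UnactuatedSpace m) ∈ W
  subset : W ⊆ Z
  contDiffOn : ContDiffOn ℝ 1 ψ W
  map_zero : ψ 0 = 0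
  output_eq : ∀ z ∈ W, ψ z 0 = inner ℝ s z
  zeroing : ∀ z ∈ W, errorCoords ω s (ψ z, z) = 0
  zeroing_unique : ∀ᶠ ζ in 𝓝 (0 : FullSpace γ m), errorCoords ω s ζ = 0 → ζ.1 = ψ ζ.2
  controlledInvariant :
    IsControlledInvariant (driftField ω) (inputField γ m)
      (fun ζ : FullSpace γ m => ζ.1 - ψ ζ.2) (univ ×ˢ W)
  expStable : IsExpStable (fun z => ω (ψ z, z)) W

end

/-! The pair (K, S) comes from pole placement. The vectors r(μ) = (1 - μA)⁻¹B are eigenvectors, with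
eigenvalue 1/μ, of A - BK whenever K r(μ) = -1/μ, and controllability makes those with small μ < 0
span the state space. A basis taken from them can be chosen so that part of it projects to a basis
of z-space; that part spans S (`exists_feedback_eigenbasis`).

Let w be the differential of y at 0. Since ω ignores η₃, …, η_γ, the Jacobian of e in η is lower
triangular. Its first diagonal entry is 1, and all others equal ∂(L_f y)/∂η₂, which for γ ≥ 2 is
also L_g L_f^{γ-1} y. If this number vanished at 0, then w, which vanishes on S together with wA,
would be a left eigenvector of A with wB = 0, against controllability (`decoupling_zero_ne_zero`).
So the relative degree is γ, and (e, z) are C¹ coordinates near 0 (`exists_errorChart`).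

At 0 the differential of L_f^k y is wA^k. Invariance of S under A - BK and wA^kB = 0 for k ≤ γ - 2
show that de vanishes on S. Hence the linearized zero dynamics are A - BK restricted to S and
written in z, which is a stable system (`fderiv_comp_symm`).

In the coordinates (e, z) the z-equation contains no input. Exponential decay of e therefore enters
it as a decaying perturbation of a stable linear system, and z decays too
(`ExpBound.exists_decay_driven`). With e = 0 this is stability of the zero dynamics; in general it
is stability of the full state under any output stabilizing feedback. The decay estimate also traps
solutions near 0, so Lipschitz closed loops have solutions for all t ≥ 0. The feedback that
linearizes the error is in general only continuous, but its closed loop is Lipschitz in the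
coordinates (e, z), where existence is checked. -/

noncomputable section

/-! ### Trapping of solutions and perturbed stable linear flows -/

section ODE

variable {E : Type*} [NormedAddCommGroup E] [NormedSpace ℝ E]

omit [NormedSpace ℝ E] in
/-- A continuous curve that starts in the ball of radius `r` and obeys the stricter bound `ρ < r`
as long as it stays in that ball never leaves the ball. -/
lemma norm_lt_of_trapped {x : ℝ → E} {T r ρ : ℝ} (hρ : ρ < r) (hc : ContinuousOn x (Ico 0 T))
    (h0 : ‖x 0‖ < r)
    (h : ∀ T' > 0, T' ≤ T → (∀ t ∈ Ico 0 T', ‖x t‖ < r) → ∀ t ∈ Ico 0 T', ‖x t‖ ≤ ρ) :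
    ∀ t ∈ Ico 0 T, ‖x t‖ < r := by
  by_contra! hcon
  obtain ⟨s, hs, hrs⟩ := hcon
  have hsub : Icc 0 s ⊆ Ico 0 T := fun t ht => ⟨ht.1, ht.2.trans_lt hs.2⟩
  have hclosed : IsClosed (Icc 0 s ∩ x ⁻¹' {v | r ≤ ‖v‖}) :=
    (hc.mono hsub).preimage_isClosed_of_isClosed isClosed_Icc
      (isClosed_le continuous_const continuous_norm)
  have hcomp : IsCompact (Icc 0 s ∩ x ⁻¹' {v | r ≤ ‖v‖}) :=
    isCompact_Icc.of_isClosed_subset hclosed inter_subset_left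
  obtain ⟨t₁, ⟨ht₁, hrt₁⟩, hleast⟩ := hcomp.exists_isLeast ⟨s, ⟨hs.1, le_rfl⟩, hrs⟩
  have hrt₁ : r ≤ ‖x t₁‖ := hrt₁
  have hpos : 0 < t₁ := by
    rcases ht₁.1.lt_or_eq with h' | h'
    · exact h'
    · rw [← h'] at hrt₁
      exact absurd hrt₁ (not_le.2 h0)
  have hlt : ∀ t ∈ Ico 0 t₁, ‖x t‖ < r := fun t ht => by
    by_contra! hle
    exact absurd (hleast ⟨⟨ht.1, ht.2.le.trans ht₁.2⟩, hle⟩) (not_le.2 ht.2)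
  have hbd := h t₁ hpos (ht₁.2.trans hs.2.le) hlt
  have hcw : ContinuousWithinAt (fun t => ‖x t‖) (Ico 0 t₁) t₁ :=
    ((hc t₁ (hsub ht₁)).mono fun t ht => hsub ⟨ht.1, ht.2.le.trans ht₁.2⟩).norm
  have hne : (𝓝[Ico 0 t₁] t₁).NeBot := by
    rw [← mem_closure_iff_nhdsWithin_neBot, closure_Ico hpos.ne]
    exact right_mem_Icc.2 hpos.le
  have := le_of_tendsto hcw (eventually_nhdsWithin_of_forall hbd)
  linarith

lemma IsSolutionOn.continuousOn {X : E → E} {D : Set E} {I : Set ℝ} {x : ℝ → E}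
    (h : IsSolutionOn X D I x) : ContinuousOn x I :=
  fun t ht => (h t ht).2.continuousWithinAt

lemma IsSolutionOn.mono {X : E → E} {D D' : Set E} {I I' : Set ℝ} {x : ℝ → E}
    (h : IsSolutionOn X D I x) (hI : I' ⊆ I) (hD : ∀ t ∈ I', x t ∈ D') :
    IsSolutionOn X D' I' x :=
  fun t ht => ⟨hD t ht, (h t (hI ht)).2.mono hI⟩

lemma exp_neg_mul_le_one {lam t : ℝ} (hlam : 0 < lam) (ht : 0 ≤ t) : Real.exp (-lam * t) ≤ 1 := by
  rw [Real.exp_le_one_iff]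
  nlinarith

/-- A decay estimate for the solutions that stay in a small ball extends to all solutions that
start close enough to the origin. -/
lemma hasExpDecay_of_ball {X : E → E} {D : Set E} {r M lam : ℝ} (hr : 0 < r) (hM : 0 < M)
    (hlam : 0 < lam)
    (h : ∀ T > (0 : ℝ), ∀ x : ℝ → E, IsSolutionOn X (D ∩ Metric.ball 0 r) (Ico 0 T) x →
      ∀ t ∈ Ico (0 : ℝ) T, ‖x t‖ ≤ M * Real.exp (-lam * t) * ‖x 0‖) :
    HasExpDecay X D := by
  -- Starting below r/(2M) keeps the decay bound at most r/2, strictly inside the ball, so the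
  -- estimate rules out an exit from the ball on which it depends.
  refine ⟨min r (r / (2 * M)), by positivity, M, hM, lam, hlam, fun T hT x hx h0 => ?_⟩
  have h1 : M * ‖x 0‖ ≤ r / 2 := by
    have := (lt_min_iff.1 h0).2.le
    rw [le_div_iff₀ (by positivity)] at this
    linarith
  have key : ∀ T' > 0, T' ≤ T → (∀ t ∈ Ico 0 T', ‖x t‖ < r) →
      ∀ t ∈ Ico (0 : ℝ) T', ‖x t‖ ≤ M * Real.exp (-lam * t) * ‖x 0‖ := fun T' hT' hle hb =>
    h T' hT' x (hx.mono (Ico_subset_Ico_right hle) fun t ht =>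
      ⟨(hx t ⟨ht.1, ht.2.trans_le hle⟩).1, by simpa using hb t ht⟩)
  have htrap : ∀ t ∈ Ico 0 T, ‖x t‖ < r := by
    refine norm_lt_of_trapped (ρ := r / 2) (by linarith) hx.continuousOn (lt_min_iff.1 h0).1
      fun T' hT' hle hb t ht => (key T' hT' hle hb t ht).trans ?_
    have := exp_neg_mul_le_one hlam ht.1
    have h3 : 0 ≤ M * ‖x 0‖ := by positivity
    nlinarith
  exact key T hT le_rfl htrap

section Linear

variable [CompleteSpace E]

lemma hasDerivAt_exp_smul_apply (A : E →L[ℝ] E) (v : E) (t : ℝ) :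
    HasDerivAt (fun t : ℝ => NormedSpace.exp (t • A) v) (A (NormedSpace.exp (t • A) v)) t := by
  have h := hasDerivAt_exp_smul_const' (𝕂 := ℝ) A t
  exact h.clm_apply (hasDerivAt_const t v) |>.congr_deriv (by simp)

omit [CompleteSpace E] in
lemma exp_zero_smul_apply (A : E →L[ℝ] E) (v : E) : NormedSpace.exp ((0 : ℝ) • A) v = v := by
  simp

lemma exp_add_smul_apply (A : E →L[ℝ] E) (s t : ℝ) (v : E) :
    NormedSpace.exp ((s + t) • A) v
      = NormedSpace.exp (s • A) (NormedSpace.exp (t • A) v) := by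
  let _ : NormedAlgebra ℚ (E →L[ℝ] E) := NormedAlgebra.restrictScalars ℚ ℝ (E →L[ℝ] E)
  rw [add_smul, NormedSpace.exp_add_of_commute]
  · rfl
  · exact ((Commute.refl A).smul_left s).smul_right t

/-- `‖exp (t A) v‖ ≤ M e^{-λ t} ‖v‖` for all `t ≥ 0`. -/
def ExpBound (A : E →L[ℝ] E) (M lam : ℝ) : Prop :=
  ∀ t : ℝ, 0 ≤ t → ∀ v : E, ‖NormedSpace.exp (t • A) v‖ ≤ M * Real.exp (-lam * t) * ‖v‖

/-- Linearity removes the smallness restriction: a nonzero v is scaled into the ball of radius δ,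
estimated there, and scaled back. -/
lemma exists_expBound_of_isExpStable {A : E →L[ℝ] E} (h : HasExpDecay (fun x => A x) univ) :
    ∃ M > 0, ∃ lam > 0, ExpBound A M lam := by
  obtain ⟨δ, hδ, M, hM, lam, hlam, H⟩ := h
  refine ⟨M, hM, lam, hlam, fun t ht v => ?_⟩
  rcases eq_or_ne v 0 with rfl | hv
  · simp
  have hv' : 0 < ‖v‖ := norm_pos_iff.2 hv
  set c : ℝ := δ / (2 * ‖v‖) with hc
  have hcpos : 0 < c := by positivity
  have := H (t + 1) (by linarith) (fun t => NormedSpace.exp (t • A) (c • v))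
    (fun s _ => ⟨mem_univ _, (hasDerivAt_exp_smul_apply A _ s).hasDerivWithinAt⟩)
    (by
      simp only [exp_zero_smul_apply, norm_smul, Real.norm_of_nonneg hcpos.le]
      rw [hc]
      field_simp
      linarith) t ⟨ht, by linarith⟩
  simp only [exp_zero_smul_apply, map_smul, norm_smul, Real.norm_of_nonneg hcpos.le] at this
  refine le_of_mul_le_mul_left ?_ hcpos
  linarith

/-- The norm adapted to a stable linear flow: `sup_{t ≥ 0} e^{λ t} ‖exp (t A) v‖`. -/
def adaptedNorm (A : E →L[ℝ] E) (lam : ℝ) (v : E) : ℝ :=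
  ⨆ t : Ici (0 : ℝ), Real.exp (lam * t) * ‖NormedSpace.exp ((t : ℝ) • A) v‖

variable {A : E →L[ℝ] E} {M lam : ℝ}

omit [CompleteSpace E] in
lemma ExpBound.le_mul (hA : ExpBound A M lam) (v : E) (t : Ici (0 : ℝ)) :
    Real.exp (lam * t) * ‖NormedSpace.exp ((t : ℝ) • A) v‖ ≤ M * ‖v‖ := by
  calc _ ≤ Real.exp (lam * t) * (M * Real.exp (-lam * t) * ‖v‖) := by
        gcongr; exact hA t t.2 v
    _ = (Real.exp (lam * t) * Real.exp (-lam * t)) * (M * ‖v‖) := by ring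
    _ = M * ‖v‖ := by rw [← Real.exp_add]; simp

lemma ExpBound.bddAbove (hA : ExpBound A M lam) (v : E) :
    BddAbove (range fun t : Ici (0 : ℝ) =>
      Real.exp (lam * t) * ‖NormedSpace.exp ((t : ℝ) • A) v‖) :=
  ⟨M * ‖v‖, by rintro _ ⟨t, rfl⟩; exact hA.le_mul v t⟩

lemma ExpBound.adaptedNorm_le (hA : ExpBound A M lam) (v : E) : adaptedNorm A lam v ≤ M * ‖v‖ :=
  ciSup_le fun t => hA.le_mul v t

lemma ExpBound.norm_le_adaptedNorm (hA : ExpBound A M lam) (v : E) : ‖v‖ ≤ adaptedNorm A lam v := by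
  have := le_ciSup (hA.bddAbove v) ⟨0, mem_Ici.2 le_rfl⟩
  simpa [adaptedNorm] using this

lemma ExpBound.adaptedNorm_add_le (hA : ExpBound A M lam) (v w : E) :
    adaptedNorm A lam (v + w) ≤ adaptedNorm A lam v + adaptedNorm A lam w := by
  refine ciSup_le fun t => ?_
  have h1 := le_ciSup (hA.bddAbove v) t
  have h2 := le_ciSup (hA.bddAbove w) t
  refine le_trans ?_ (add_le_add h1 h2)
  rw [map_add, ← mul_add]
  gcongr
  exact norm_add_le _ _

/-- Shifting time by h inside the supremum costs the factor e^{-λh}. In this norm the flow contracts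
immediately, with constant 1 instead of M, which is what a differential inequality needs. -/
lemma ExpBound.adaptedNorm_exp_le (hA : ExpBound A M lam) {h : ℝ} (hh : 0 ≤ h) (v : E) :
    adaptedNorm A lam (NormedSpace.exp (h • A) v)
      ≤ Real.exp (-lam * h) * adaptedNorm A lam v := by
  refine ciSup_le fun t => ?_
  have h1 := le_ciSup (hA.bddAbove v) ⟨t + h, add_nonneg t.2 hh⟩
  calc _ = Real.exp (-lam * h) *
        (Real.exp (lam * (t + h)) * ‖NormedSpace.exp (((t : ℝ) + h) • A) v‖) := by
        rw [exp_add_smul_apply, ← mul_assoc, ← Real.exp_add]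
        ring_nf
    _ ≤ _ := by gcongr; exact h1

/-- Upper right Dini derivative of the adapted norm along a perturbed linear flow. -/
lemma ExpBound.eventually_slope_lt (hA : ExpBound A M lam) {z : ℝ → E} {t : ℝ} {r : E}
    (hz : HasDerivWithinAt z (A (z t) + r) (Ici t) t) {q : ℝ}
    (hq : -lam * adaptedNorm A lam (z t) + M * ‖r‖ < q) :
    ∀ᶠ s in 𝓝[>] t, slope (fun s => adaptedNorm A lam (z s)) t s < q := by
  set N := adaptedNorm A lam
  have hexp : HasDerivAt (fun s : ℝ => NormedSpace.exp ((s - t) • A) (z t)) (A (z t)) t := by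
    have h1 : HasDerivAt (fun s : ℝ => NormedSpace.exp (s • A) (z t)) (A (z t)) (t - t) := by
      simpa using hasDerivAt_exp_smul_apply A (z t) (t - t)
    exact h1.comp_sub_const t t
  have hp : HasDerivWithinAt (fun s => z s - NormedSpace.exp ((s - t) • A) (z t)) r (Ioi t) t :=
    ((hz.mono Ioi_subset_Ici_self).sub hexp.hasDerivWithinAt).congr_deriv (by simp)
  have hp' := ((hasDerivWithinAt_iff_tendsto_slope' (by simp)).1 hp).norm
  have he : HasDerivWithinAt (fun s => Real.exp (-lam * (s - t))) (-lam) (Ioi t) t := by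
    have h1 : HasDerivAt (fun s => -lam * (s - t)) (-lam) t := by
      simpa using ((hasDerivAt_id t).sub_const t).const_mul (-lam)
    simpa using h1.exp.hasDerivWithinAt
  have he' := (hasDerivWithinAt_iff_tendsto_slope' (by simp)).1 he
  have hlim := (he'.mul_const (N (z t))).add (hp'.const_mul M)
  filter_upwards [hlim.eventually_lt_const hq, self_mem_nhdsWithin] with s hs hst
  refine lt_of_le_of_lt ?_ hs
  have hst : 0 < s - t := sub_pos.2 hst
  -- The comparison is with the unperturbed flow started at z(t): that flow contracts the adapted
  -- norm, and the deviation from it is (s - t) r + o(s - t).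
  have hdecomp : N (z s) ≤ Real.exp (-lam * (s - t)) * N (z t)
      + M * ‖z s - NormedSpace.exp ((s - t) • A) (z t)‖ := by
    calc N (z s) = N (NormedSpace.exp ((s - t) • A) (z t)
          + (z s - NormedSpace.exp ((s - t) • A) (z t))) := by simp
      _ ≤ _ := (hA.adaptedNorm_add_le _ _).trans
        (add_le_add (hA.adaptedNorm_exp_le hst.le _) (hA.adaptedNorm_le _))
  simp only [slope_def_field, slope_def_module, sub_self, mul_zero, Real.exp_zero, zero_smul,
    NormedSpace.exp_zero, one_apply_eq_self, sub_zero, norm_smul, norm_inv,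
    Real.norm_of_nonneg hst.le]
  rw [div_le_iff₀ hst]
  have : ((Real.exp (-lam * (s - t)) - 1) / (s - t) * N (z t) +
      M * ((s - t)⁻¹ * ‖z s - NormedSpace.exp ((s - t) • A) (z t)‖)) * (s - t)
      = (Real.exp (-lam * (s - t)) - 1) * N (z t)
        + M * ‖z s - NormedSpace.exp ((s - t) • A) (z t)‖ := by
    field_simp
  rw [this]
  linarith

/-- Exponential decay of the solutions of `z' = A z + r` for a stable `A` and a perturbation `r`
that is small relative to `z` up to an exponentially decaying term. -/
lemma ExpBound.exists_decay (hA : ExpBound A M lam) (hM : 0 < M) (hlam : 0 < lam) :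
    ∃ ε > 0, ∀ C ≥ 0, ∀ κ > 0, ∃ M' > 0, ∃ ν > 0, ν ≤ κ ∧
      ∀ T : ℝ, ∀ z r : ℝ → E, ∀ a ≥ 0,
        (∀ t ∈ Ico 0 T, HasDerivWithinAt z (A (z t) + r t) (Ico 0 T) t) →
        (∀ t ∈ Ico 0 T, ‖r t‖ ≤ ε * ‖z t‖ + C * a * Real.exp (-κ * t)) →
        ∀ t ∈ Ico 0 T, ‖z t‖ ≤ M' * Real.exp (-ν * t) * (‖z 0‖ + a) := by
  -- Budget for the rate λ: this ε spends half of it on the part of r proportional to z, a quarter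
  -- absorbs the decaying forcing, and the last quarter covers ν.
  refine ⟨lam / (2 * M), by positivity, fun C hC κ hκ => ?_⟩
  set ν := min lam κ / 4 with hν
  have hνpos : 0 < ν := by positivity
  have hνlam : ν ≤ lam / 4 := by rw [hν]; gcongr; exact min_le_left _ _
  have hνκ : ν ≤ κ := by
    have : min lam κ ≤ κ := min_le_right _ _
    rw [hν]; linarith
  refine ⟨M + 4 * M * C / lam, by positivity, ν, hνpos, hνκ, fun T z r a ha hz hr t ht => ?_⟩
  -- The slack η makes the barrier Q e^{-νs} positive and the inequality at a touching point strict,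
  -- as the comparison theorem requires.
  refine le_of_forall_pos_le_add fun η hη => ?_
  set Q := M * ‖z 0‖ + 4 * M * C / lam * a + η with hQ
  have hz0 := norm_nonneg (z 0)
  have hcont : ContinuousOn z (Ico 0 T) := fun s hs => (hz s hs).continuousWithinAt
  have hIcc : Icc 0 t ⊆ Ico 0 T := fun s hs => ⟨hs.1, hs.2.trans_lt ht.2⟩
  have hright : ∀ s ∈ Ico 0 t, HasDerivWithinAt z (A (z s) + r s) (Ici s) s := fun s hs => by
    have hsT : s < T := hs.2.trans ht.2
    refine (hz s ⟨hs.1, hsT⟩).mono_of_mem_nhdsWithin ?_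
    filter_upwards [Ico_mem_nhdsGE hsT] with u hu using ⟨hs.1.trans hu.1, hu.2⟩
  have hNcont : Continuous (adaptedNorm A lam) := by
    have : LipschitzWith (Real.toNNReal M) (adaptedNorm A lam) := by
      refine LipschitzWith.of_le_add_mul _ fun v w => ?_
      have h1 := hA.adaptedNorm_add_le w (v - w)
      have h2 := hA.adaptedNorm_le (v - w)
      rw [add_sub_cancel] at h1
      rw [Real.coe_toNNReal _ hM.le, dist_eq_norm]
      linarith
    exact this.continuous
  have main : adaptedNorm A lam (z t) ≤ Q * Real.exp (-ν * t) := by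
    refine image_le_of_liminf_slope_right_lt_deriv_boundary
      (f := fun s => adaptedNorm A lam (z s))
      (f' := fun s => -lam * adaptedNorm A lam (z s) + M * ‖r s‖)
      (B := fun s => Q * Real.exp (-ν * s)) (B' := fun s => Q * (Real.exp (-ν * s) * -ν))
      (a := 0) (b := t) ?_ ?_ ?_ ?_ ?_ (right_mem_Icc.2 ht.1)
    · exact hNcont.comp_continuousOn (hcont.mono hIcc)
    · exact fun s hs q hq => (hA.eventually_slope_lt (hright s hs) hq).frequently
    · have := hA.adaptedNorm_le (z 0)
      have h2 : 0 ≤ 4 * M * C / lam * a := by positivity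
      simp only [mul_zero, Real.exp_zero, mul_one]
      linarith
    · intro s
      have h1 : HasDerivAt (fun s => -ν * s) (-ν) s := by
        simpa using (hasDerivAt_id s).const_mul (-ν)
      exact h1.exp.const_mul Q
    · intro s hs heq
      have hr' := hr s (hIcc ⟨hs.1, hs.2.le⟩)
      have hn := hA.norm_le_adaptedNorm (z s)
      have hexp : Real.exp (-κ * s) ≤ Real.exp (-ν * s) := by
        apply Real.exp_le_exp.2
        nlinarith [hs.1]
      have hpos := Real.exp_pos (-ν * s)
      have h1 : M * ‖r s‖ ≤ lam / 2 * adaptedNorm A lam (z s)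
          + M * C * a * Real.exp (-ν * s) := by
        calc M * ‖r s‖ ≤ M * (lam / (2 * M) * adaptedNorm A lam (z s)
              + C * a * Real.exp (-ν * s)) := by
              gcongr
              refine hr'.trans ?_
              gcongr
          _ = _ := by field_simp
      have hQ' : M * C * a < lam / 4 * Q := by
        have e1 : lam / 4 * Q = lam / 4 * (M * ‖z 0‖ + η) + M * C * a := by
          rw [hQ]; field_simp; ring
        have e2 : 0 < lam / 4 * (M * ‖z 0‖ + η) := by positivity
        linarith
      have hQpos : 0 < Q := by positivity
      have h2 : M * C * a * Real.exp (-ν * s) < lam / 4 * Q * Real.exp (-ν * s) := by gcongr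
      have h3 : ν * (Q * Real.exp (-ν * s)) ≤ lam / 4 * (Q * Real.exp (-ν * s)) := by gcongr
      rw [heq] at h1 ⊢
      linarith
  have he1 : Real.exp (-ν * t) ≤ 1 := exp_neg_mul_le_one hνpos ht.1
  have hepos := Real.exp_pos (-ν * t)
  calc ‖z t‖ ≤ Q * Real.exp (-ν * t) := (hA.norm_le_adaptedNorm _).trans main
    _ = (M * ‖z 0‖ + 4 * M * C / lam * a) * Real.exp (-ν * t) + η * Real.exp (-ν * t) := by
        rw [hQ]; ring
    _ ≤ (M + 4 * M * C / lam) * (‖z 0‖ + a) * Real.exp (-ν * t) + η * 1 := by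
        gcongr
        have h1 : 0 ≤ 4 * M * C / lam * ‖z 0‖ := by positivity
        have h2 : 0 ≤ M * a := by positivity
        nlinarith
    _ = _ := by ring

end Linear

end ODE


/-! ### Cascade estimate for a stable system driven by a decaying signal -/

section Cascade

variable {G F : Type*} [NormedAddCommGroup G] [NormedSpace ℝ G]
  [NormedAddCommGroup F] [NormedSpace ℝ F] [CompleteSpace F]

/-- Decay of the driven system `z' = h (e, z)` for a decaying signal `e`, where only the
linearization of `h` at the origin is known to be stable in `z`. -/
lemma ExpBound.exists_decay_driven {A : F →L[ℝ] F} {M lam : ℝ} (hA : ExpBound A M lam)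
    (hM : 0 < M) (hlam : 0 < lam) {h : G × F → F} {h' : G × F →L[ℝ] F}
    (hh : HasFDerivAt h h' 0) (h0 : h 0 = 0) (hhA : ∀ w, h' (0, w) = A w)
    {Me κ : ℝ} (hMe : 0 < Me) (hκ : 0 < κ) :
    ∃ r > 0, ∃ M' > 0, ∃ ν > 0, ∀ (T : ℝ) (e : ℝ → G) (z : ℝ → F),
      (∀ t ∈ Ico 0 T, HasDerivWithinAt z (h (e t, z t)) (Ico 0 T) t) →
      (∀ t ∈ Ico 0 T, ‖(e t, z t)‖ < r) →
      (∀ t ∈ Ico 0 T, ‖e t‖ ≤ Me * Real.exp (-κ * t) * ‖e 0‖) →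
      ∀ t ∈ Ico 0 T, ‖(e t, z t)‖ ≤ M' * Real.exp (-ν * t) * ‖(e 0, z 0)‖ := by
  obtain ⟨ε, hε, H⟩ := hA.exists_decay hM hlam
  obtain ⟨M', hM', ν, hν, hνκ, H⟩ := H ((ε + ‖h'‖) * Me) (by positivity) κ hκ
  have hlin : ∀ᶠ x in 𝓝 (0 : G × F), ‖h x - h' x‖ ≤ ε * ‖x‖ := by
    have := hh.isLittleO.bound hε
    simpa [h0] using this
  obtain ⟨r, hr, hball⟩ := Metric.eventually_nhds_iff_ball.1 hlin
  refine ⟨r, hr, 2 * M' + Me, by positivity, ν, hν, fun T e z hz hb he t ht => ?_⟩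
  -- The perturbation h(e, z) - Az is the Taylor remainder, at most ε‖(e, z)‖, plus h'(e, 0), which
  -- decays with e.
  have hzt := H T z (fun t => h (e t, z t) - A (z t)) ‖e 0‖ (norm_nonneg _)
    (fun t ht => by simpa using hz t ht) (fun t ht => by
      have h1 := hball (e t, z t) (by simpa using hb t ht)
      have h2 : h' (e t, z t) = h' (e t, 0) + A (z t) := by
        rw [← hhA, ← map_add]; simp
      have h3 : ‖h' (e t, 0)‖ ≤ ‖h'‖ * ‖e t‖ := by
        simpa using h'.le_opNorm (e t, 0)
      have h4 : ‖(e t, z t)‖ ≤ ‖e t‖ + ‖z t‖ := by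
        rw [Prod.norm_mk]
        exact max_le_add_of_nonneg (norm_nonneg _) (norm_nonneg _)
      calc ‖h (e t, z t) - A (z t)‖
          = ‖(h (e t, z t) - h' (e t, z t)) + h' (e t, 0)‖ := by rw [h2]; congr 1; abel
        _ ≤ ε * (‖e t‖ + ‖z t‖) + ‖h'‖ * ‖e t‖ := by
          refine (norm_add_le _ _).trans (add_le_add (h1.trans ?_) h3)
          gcongr
        _ = ε * ‖z t‖ + (ε + ‖h'‖) * ‖e t‖ := by ring
        _ ≤ ε * ‖z t‖ + (ε + ‖h'‖) * (Me * Real.exp (-κ * t) * ‖e 0‖) := by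
          gcongr; exact he t ht
        _ = _ := by ring) t ht
  have hnz : ‖z 0‖ ≤ ‖(e 0, z 0)‖ := norm_snd_le (e 0, z 0)
  have hne : ‖e 0‖ ≤ ‖(e 0, z 0)‖ := norm_fst_le (e 0, z 0)
  have hexp : Real.exp (-κ * t) ≤ Real.exp (-ν * t) :=
    Real.exp_le_exp.2 (by nlinarith [ht.1])
  rw [Prod.norm_mk (e t)]
  refine max_le ?_ ?_
  · calc ‖e t‖ ≤ Me * Real.exp (-κ * t) * ‖e 0‖ := he t ht
      _ ≤ Me * Real.exp (-ν * t) * ‖(e 0, z 0)‖ := by gcongr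
      _ ≤ _ := by gcongr; linarith
  · calc ‖z t‖ ≤ M' * Real.exp (-ν * t) * (‖z 0‖ + ‖e 0‖) := hzt
      _ ≤ M' * Real.exp (-ν * t) * (‖(e 0, z 0)‖ + ‖(e 0, z 0)‖) := by gcongr
      _ = 2 * M' * Real.exp (-ν * t) * ‖(e 0, z 0)‖ := by ring
      _ ≤ _ := by gcongr; linarith

end Cascade

/-! ### Existence of solutions for all positive times -/

section Global

variable {E : Type*} [NormedAddCommGroup E] [NormedSpace ℝ E]

/-- If from every point there starts a solution of `x' = X x` on a time interval of the fixed
length `τ`, then from every point there starts a solution on `[0, ∞)`. -/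
lemma exists_solution_Ici_of_uniform_step {X : E → E} {τ : ℝ} (hτ : 0 < τ)
    (h : ∀ p, ∃ x : ℝ → E, x 0 = p ∧
      ∀ t ∈ Icc 0 τ, HasDerivWithinAt x (X (x t)) (Icc 0 τ) t) (p : E) :
    ∃ x : ℝ → E, x 0 = p ∧ ∀ t ∈ Ici (0 : ℝ), HasDerivWithinAt x (X (x t)) (Ici 0) t := by
  choose S hS0 hS using h
  let q : ℕ → E := fun n => Nat.rec p (fun _ q => S q τ) n
  let x : ℝ → E := fun t => S (q ⌊t / τ⌋₊) (t - ⌊t / τ⌋₊ * τ)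
  have hx : ∀ n : ℕ, ∀ t ∈ Icc (n * τ) ((n + 1) * τ), x t = S (q n) (t - n * τ) := by
    intro n t ht
    have hn0 : (0 : ℝ) ≤ n := n.cast_nonneg
    have ht0 : 0 ≤ t / τ := div_nonneg (le_trans (by positivity) ht.1) hτ.le
    rcases ht.2.lt_or_eq with hlt | heq
    · have : ⌊t / τ⌋₊ = n := by
        rw [Nat.floor_eq_iff ht0, le_div_iff₀ hτ, div_lt_iff₀ hτ]
        exact ⟨ht.1, hlt⟩
      simp only [x, this]
    · have : ⌊t / τ⌋₊ = n + 1 := by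
        rw [heq, mul_div_cancel_right₀ _ hτ.ne']
        exact_mod_cast Nat.floor_natCast (n + 1)
      have e1 : t - ((n + 1 : ℕ) : ℝ) * τ = 0 := by rw [heq]; push_cast; ring
      have e2 : t - n * τ = τ := by rw [heq]; ring
      simp only [x, this, e1, e2, hS0]
      rfl
  have hd : ∀ n : ℕ, ∀ t ∈ Icc (n * τ) ((n + 1) * τ),
      HasDerivWithinAt x (X (x t)) (Icc (n * τ) ((n + 1) * τ)) t := by
    intro n t ht
    have hmaps : MapsTo (fun t => t - n * τ) (Icc (n * τ) ((n + 1) * τ)) (Icc 0 τ) :=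
      fun s hs => ⟨by linarith [hs.1], by linarith [hs.2]⟩
    have h1 := (hS (q n) (t - n * τ) (hmaps ht)).scomp t
      ((hasDerivAt_id t).sub_const (n * τ)).hasDerivWithinAt hmaps
    rw [one_smul, ← hx n t ht] at h1
    exact h1.congr (fun s hs => hx n s hs) (hx n t ht)
  refine ⟨x, by simp [x, hS0, q], fun t ht => ?_⟩
  have ht0 : 0 ≤ t / τ := div_nonneg ht hτ.le
  set n := ⌊t / τ⌋₊ with hn
  have hn1 : n * τ ≤ t := (le_div_iff₀ hτ).1 (Nat.floor_le ht0)
  have hn2 : t < (n + 1) * τ := (div_lt_iff₀ hτ).1 (Nat.lt_floor_add_one _)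
  have hright := hd n t ⟨hn1, hn2.le⟩
  rcases hn1.lt_or_eq with hlt | heq
  · exact (hright.hasDerivAt (Icc_mem_nhds hlt hn2)).hasDerivWithinAt
  · rcases Nat.eq_zero_or_pos n with h0 | hpos
    · rw [h0] at hright hn2 heq
      simp only [Nat.cast_zero, zero_mul, zero_add, one_mul] at hright hn2 heq
      refine hright.mono_of_mem_nhdsWithin ?_
      rw [← heq]
      exact Icc_mem_nhdsGE hτ
    · obtain ⟨j, hj⟩ : ∃ j, n = j + 1 := ⟨n - 1, by omega⟩
      have hcast : (n : ℝ) = j + 1 := by rw [hj]; push_cast; ring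
      have hleft := hd j t ⟨by rw [← heq, hcast]; nlinarith, by rw [← heq, hcast]⟩
      have hu := hleft.union hright
      rw [← hcast, heq, Icc_union_Icc_eq_Icc (by rw [← heq, hcast]; nlinarith) hn2.le] at hu
      exact (hu.hasDerivAt (Icc_mem_nhds (by rw [← heq, hcast]; nlinarith) hn2)).hasDerivWithinAt

/-- Picard–Lindelöf is run on a ball whose radius is proportional to ‖X p‖. The admissible step then
depends only on the Lipschitz constant, so steps of equal length can be chained. -/
lemma exists_solution_Ici_of_lipschitzWith [CompleteSpace E] {X : E → E} {K : NNReal}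
    (hX : LipschitzWith K X) (p : E) :
    ∃ x : ℝ → E, x 0 = p ∧ ∀ t ∈ Ici (0 : ℝ), HasDerivWithinAt x (X (x t)) (Ici 0) t := by
  set τ : ℝ := 1 / (2 * (K + 1)) with hτ
  have hτpos : 0 < τ := by positivity
  refine exists_solution_Ici_of_uniform_step hτpos (fun p => ?_) p
  set a : NNReal := ‖X p‖₊ / (K + 1) with ha
  have hpl : IsPicardLindelof (fun _ => X) (tmin := 0) (tmax := τ) ⟨0, le_rfl, hτpos.le⟩ p a 0
      (‖X p‖₊ + K * a) K := by
    refine IsPicardLindelof.of_time_independent (fun x hx => ?_) hX.lipschitzOnWith ?_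
    · have h1 := hX.dist_le_mul x p
      have h2 : K * dist x p ≤ K * (a : ℝ) := by gcongr; exact hx
      have h3 : ‖X x‖ ≤ ‖X p‖ + dist (X x) (X p) := by
        rw [dist_eq_norm]
        simpa using norm_add_le (X p) (X x - X p)
      push_cast
      linarith
    · simp only [NNReal.coe_zero, sub_zero, ha, hτ]
      push_cast
      have : (0 : ℝ) ≤ K := K.2
      have hp := norm_nonneg (X p)
      rw [max_eq_left (by positivity), mul_one_div, div_le_div_iff₀ (by positivity) (by positivity)]
      have h4 : (K : ℝ) * (‖X p‖ / (K + 1)) ≤ ‖X p‖ := by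
        rw [mul_div_assoc', div_le_iff₀ (by positivity)]
        nlinarith
      have h5 : (0 : ℝ) ≤ K + 1 := by positivity
      nlinarith [mul_le_mul_of_nonneg_right h4 h5]
  exact hpl.exists_eq_forall_mem_Icc_hasDerivWithinAt₀

/-- Near a locally exponentially attracting origin, the solutions of a Lipschitz vector field exist
for all times. -/
lemma HasExpDecay.hasGlobalSolutions [FiniteDimensional ℝ E] {X : E → E} {D : Set E}
    (hdec : HasExpDecay X D) (hD : D ∈ 𝓝 (0 : E)) {L : NNReal} {U : Set E} (hU : U ∈ 𝓝 (0 : E))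
    (hX : LipschitzOnWith L X U) : HasGlobalSolutions X D := by
  have : CompleteSpace E := FiniteDimensional.complete ℝ E
  obtain ⟨δ, hδ, M, hM, lam, hlam, H⟩ := hdec
  obtain ⟨r, hr, hrU⟩ := Metric.mem_nhds_iff.1 (inter_mem hU hD)
  obtain ⟨Y, hY, hXY⟩ := hX.extend_finite_dimension
  refine ⟨min δ (min r (r / (2 * M))), by positivity, fun p hp => ?_⟩
  obtain ⟨hpδ, hp⟩ := lt_min_iff.1 hp
  obtain ⟨hpr, hpM⟩ := lt_min_iff.1 hp
  rw [lt_div_iff₀ (by positivity)] at hpM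
  -- The solution is that of a globally Lipschitz extension Y; the decay estimate traps it in the
  -- ball where Y = X.
  obtain ⟨x, hx0, hx⟩ := exists_solution_Ici_of_lipschitzWith hY p
  have key : ∀ T', (∀ t ∈ Ico 0 T', ‖x t‖ < r) → IsSolutionOn X D (Ico 0 T') x := by
    intro T' hb t ht
    have hmem := hrU (mem_ball_zero_iff.2 (hb t ht))
    refine ⟨hmem.2, ?_⟩
    rw [hXY hmem.1]
    exact (hx t ht.1).mono Ico_subset_Ici_self
  have htrap : ∀ T, ∀ t ∈ Ico 0 T, ‖x t‖ < r := fun T => by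
    refine norm_lt_of_trapped (ρ := r / 2) (by linarith)
      (fun t ht => (hx t ht.1).continuousWithinAt.mono Ico_subset_Ici_self) (by rwa [hx0]) ?_
    intro T' hT' _ hb t ht
    have h1 := H T' hT' x (key T' hb) (by rwa [hx0]) t ht
    have h2 := exp_neg_mul_le_one hlam ht.1
    rw [hx0] at h1
    have h3 : 0 ≤ M * ‖p‖ := by positivity
    nlinarith
  refine ⟨x, hx0, fun t ht => ?_⟩
  have hmem := hrU (mem_ball_zero_iff.2 (htrap (t + 1) t ⟨ht, by linarith⟩))
  refine ⟨hmem.2, ?_⟩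
  rw [hXY hmem.1]
  exact hx t ht

end Global


/-! ### Quadratic Lyapunov functions -/

section QuadraticLyapunov

variable {F : Type*} [NormedAddCommGroup F] [NormedSpace ℝ F]

/-- Gronwall's inequality for `v' ≤ -k v`. -/
lemma le_mul_exp_of_deriv_le {v v' : ℝ → ℝ} {T k : ℝ}
    (hv : ∀ t ∈ Ico 0 T, HasDerivWithinAt v (v' t) (Ico 0 T) t)
    (hle : ∀ t ∈ Ico 0 T, v' t ≤ -k * v t) :
    ∀ t ∈ Ico 0 T, v t ≤ v 0 * Real.exp (-k * t) := by
  intro t ht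
  have hexp : ∀ s, HasDerivAt (fun s => Real.exp (k * s)) (Real.exp (k * s) * k) s := fun s => by
    have h1 : HasDerivAt (fun s => k * s) k s := by
      simpa using (hasDerivAt_id s).const_mul k
    exact h1.exp
  have hanti : AntitoneOn (fun s => v s * Real.exp (k * s)) (Ico 0 T) := by
    refine antitoneOn_of_hasDerivWithinAt_nonpos (convex_Ico 0 T)
      (f' := fun s => v' s * Real.exp (k * s) + v s * (Real.exp (k * s) * k)) ?_ ?_ ?_
    · exact fun s hs => (hv s hs).continuousWithinAt.mul (hexp s).continuousAt.continuousWithinAt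
    · exact fun s hs => ((hv s (interior_subset hs)).mul (hexp s).hasDerivWithinAt).mono
        interior_subset
    · intro s hs
      have := hle s (interior_subset hs)
      have hp := Real.exp_pos (k * s)
      nlinarith
  have h1 := hanti ⟨le_rfl, ht.1.trans_lt ht.2⟩ ht ht.1
  simp only [mul_zero, Real.exp_zero, mul_one] at h1
  calc v t = v t * Real.exp (k * t) * Real.exp (-k * t) := by
        rw [mul_assoc, ← Real.exp_add]; simp
    _ ≤ v 0 * Real.exp (-k * t) := by gcongr

omit [NormedSpace ℝ F] in
/-- Exponential decay of a curve along which a quadratically bounded function decays. -/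
lemma norm_le_of_lyapunov {V : F → ℝ} {k₁ k₂ k₃ : ℝ} (hk₁ : 0 < k₁) (hk₂ : 0 < k₂)
    (hV : ∀ a : F, k₁ * ‖a‖ ^ 2 ≤ V a ∧ V a ≤ k₂ * ‖a‖ ^ 2) {T : ℝ} {e : ℝ → F} {v' : ℝ → ℝ}
    (hd : ∀ t ∈ Ico 0 T, HasDerivWithinAt (fun s => V (e s)) (v' t) (Ico 0 T) t)
    (hle : ∀ t ∈ Ico 0 T, v' t ≤ -k₃ * V (e t)) :
    ∀ t ∈ Ico 0 T, ‖e t‖ ≤ √(k₂ / k₁) * Real.exp (-(k₃ / 2) * t) * ‖e 0‖ := by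
  intro t ht
  have h1 := le_mul_exp_of_deriv_le hd hle t ht
  have h2 : k₁ * ‖e t‖ ^ 2 ≤ k₂ * ‖e 0‖ ^ 2 * Real.exp (-k₃ * t) :=
    ((hV _).1.trans h1).trans (by gcongr; exact (hV _).2)
  refine le_of_sq_le_sq ?_ (by positivity)
  rw [mul_pow, mul_pow, Real.sq_sqrt (by positivity), ← Real.exp_nat_mul]
  have e1 : ((2 : ℕ) : ℝ) * (-(k₃ / 2) * t) = -k₃ * t := by push_cast; ring
  rw [e1, div_mul_eq_mul_div, div_mul_eq_mul_div, le_div_iff₀ hk₁]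
  linarith

/-- A quadratic Lyapunov function for a diagonalizable operator with negative eigenvalues. -/
lemma exists_lyapunov_of_eigenbasis {ι : Type*} [Fintype ι] (b : Module.Basis ι ℝ F)
    {L : F →L[ℝ] F} {μ : ι → ℝ} (hμ : ∀ i, μ i < 0) (hL : ∀ i, L (b i) = μ i • b i) :
    ∃ V : F → ℝ, Differentiable ℝ V ∧ ∃ k₁ > (0 : ℝ), ∃ k₂ > (0 : ℝ), ∃ k₃ > (0 : ℝ),
      (∀ a : F, k₁ * ‖a‖ ^ 2 ≤ V a ∧ V a ≤ k₂ * ‖a‖ ^ 2) ∧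
      ∀ a, fderiv ℝ V a (L a) ≤ -k₃ * V a := by
  have : FiniteDimensional ℝ F := b.finiteDimensional_of_finite
  let T : F ≃L[ℝ] EuclideanSpace ℝ ι := b.equivFunL.trans (EuclideanSpace.equiv ι ℝ).symm
  have hT : ∀ a i, T a i = b.repr a i := fun a i => rfl
  have hTL : ∀ a i, T (L a) i = μ i * T a i := by
    intro a i
    have h1 : L a = ∑ j, (b.repr a j * μ j) • b j := by
      conv_lhs => rw [← b.sum_repr a, map_sum]
      exact Finset.sum_congr rfl fun j _ => by rw [map_smul, hL, smul_smul]
    rw [hT, hT, h1, b.repr_sum_self, mul_comm]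
  obtain ⟨k, hk, hkμ⟩ : ∃ k > 0, ∀ i, μ i ≤ -k := by
    have h1 : ∀ᶠ k in 𝓝[>] (0 : ℝ), ∀ i, μ i ≤ -k := by
      refine eventually_all.2 fun i => ?_
      filter_upwards [Ioo_mem_nhdsGT (neg_pos.2 (hμ i))] with k hk
      linarith [hk.2]
    obtain ⟨k, h1, h2⟩ := (h1.and self_mem_nhdsWithin).exists
    exact ⟨k, h2, h1⟩
  have hd : ∀ a, HasFDerivAt (fun a => ‖T a‖ ^ 2)
      (2 • (innerSL ℝ (T a)).comp (T : F →L[ℝ] EuclideanSpace ℝ ι)) a := fun a =>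
    T.hasFDerivAt.norm_sq
  -- V is the squared Euclidean norm in eigenbasis coordinates. The added 1 keeps both bounds
  -- positive on the zero space, where the operator norms vanish.
  refine ⟨fun a => ‖T a‖ ^ 2, fun a => (hd a).differentiableAt,
    1 / (‖(T.symm : EuclideanSpace ℝ ι →L[ℝ] F)‖ ^ 2 + 1), by positivity,
    ‖(T : F →L[ℝ] EuclideanSpace ℝ ι)‖ ^ 2 + 1, by positivity, 2 * k, by positivity,
    fun a => ⟨?_, ?_⟩, fun a => ?_⟩
  · have h1 : ‖a‖ ≤ ‖(T.symm : EuclideanSpace ℝ ι →L[ℝ] F)‖ * ‖T a‖ := by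
      simpa using (T.symm : EuclideanSpace ℝ ι →L[ℝ] F).le_opNorm (T a)
    rw [div_mul_eq_mul_div, one_mul, div_le_iff₀ (by positivity)]
    calc ‖a‖ ^ 2 ≤ (‖(T.symm : EuclideanSpace ℝ ι →L[ℝ] F)‖ * ‖T a‖) ^ 2 := by gcongr
      _ ≤ _ := by rw [mul_pow]; nlinarith [sq_nonneg ‖T a‖]
  · have h1 : ‖T a‖ ≤ ‖(T : F →L[ℝ] EuclideanSpace ℝ ι)‖ * ‖a‖ :=
      (T : F →L[ℝ] EuclideanSpace ℝ ι).le_opNorm a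
    calc ‖T a‖ ^ 2 ≤ (‖(T : F →L[ℝ] EuclideanSpace ℝ ι)‖ * ‖a‖) ^ 2 := by gcongr
      _ ≤ _ := by rw [mul_pow]; nlinarith [sq_nonneg ‖a‖]
  · rw [(hd a).fderiv]
    simp only [EuclideanSpace.norm_sq_eq, smul_apply, ContinuousLinearMap.comp_apply,
      innerSL_apply_apply, PiLp.inner_apply, ContinuousLinearEquiv.coe_coe, hTL, nsmul_eq_mul,
      Finset.mul_sum]
    refine Finset.sum_le_sum fun i _ => ?_
    have := mul_le_mul_of_nonneg_right (hkμ i) (sq_nonneg (T a i))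
    simp only [RCLike.inner_apply, conj_trivial, Real.norm_eq_abs, sq_abs]
    push_cast
    linarith

lemma isExpStable_of_eigenbasis {ι : Type*} [Fintype ι] (b : Module.Basis ι ℝ F)
    {L : F →L[ℝ] F} {μ : ι → ℝ} (hμ : ∀ i, μ i < 0) (hL : ∀ i, L (b i) = μ i • b i) :
    IsExpStable (fun a => L a) univ := by
  have : FiniteDimensional ℝ F := b.finiteDimensional_of_finite
  have : CompleteSpace F := FiniteDimensional.complete ℝ F
  obtain ⟨V, hV, k₁, hk₁, k₂, hk₂, k₃, hk₃, hb, hle⟩ := exists_lyapunov_of_eigenbasis b hμ hL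
  constructor
  · refine ⟨1, one_pos, fun p _ => ?_⟩
    obtain ⟨x, hx0, hx⟩ := exists_solution_Ici_of_lipschitzWith L.lipschitz p
    exact ⟨x, hx0, fun t ht => ⟨mem_univ _, hx t ht⟩⟩
  · refine ⟨1, one_pos, √(k₂ / k₁), by positivity, k₃ / 2, by positivity, fun T hT x hx _ => ?_⟩
    exact norm_le_of_lyapunov hk₁ hk₂ hb
      (fun t ht => (hV (x t)).hasFDerivAt.comp_hasDerivWithinAt t (hx t ht).2)
      (fun t ht => hle (x t))

end QuadraticLyapunov

/-! ### Pole placement by resolvent vectors -/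

section PolePlacement

variable {E : Type*} [NormedAddCommGroup E] [NormedSpace ℝ E] [FiniteDimensional ℝ E]

/-- `(1 - μ A)⁻¹ b`. -/
def resolventVec (A : E →L[ℝ] E) (b : E) (μ : ℝ) : E := Ring.inverse (1 - μ • A) b

-- For μ ≠ 0 this reads A r + b/μ = r/μ: the vector r is an eigenvector of A - bK for 1/μ as soon as
-- K r = -1/μ.
omit [FiniteDimensional ℝ E] in
lemma resolventVec_eq {A : E →L[ℝ] E} {μ : ℝ} (h : IsUnit (1 - μ • A)) (b : E) :
    resolventVec A b μ = b + μ • A (resolventVec A b μ) := by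
  have h1 := congrArg (fun T : E →L[ℝ] E => T b) (Ring.mul_inverse_cancel _ h)
  have h2 : resolventVec A b μ - μ • A (resolventVec A b μ) = b := h1
  exact sub_eq_iff_eq_add.1 h2

lemma continuousAt_resolventVec (A : E →L[ℝ] E) (b : E) : ContinuousAt (resolventVec A b) 0 := by
  have : CompleteSpace E := FiniteDimensional.complete ℝ E
  have h1 : ContinuousAt (fun μ : ℝ => 1 - μ • A) 0 := by fun_prop
  have h2 : ContinuousAt Ring.inverse ((fun μ : ℝ => 1 - μ • A) 0) := by
    simpa using NormedRing.inverse_continuousAt (1 : (E →L[ℝ] E)ˣ)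
  exact (ContinuousAt.comp (f := fun μ : ℝ => 1 - μ • A) h2 h1).clm_apply continuousAt_const

lemma eventually_isUnit_one_sub_smul (A : E →L[ℝ] E) : ∀ᶠ μ : ℝ in 𝓝 0, IsUnit (1 - μ • A) := by
  have : CompleteSpace E := FiniteDimensional.complete ℝ E
  have h1 : Tendsto (fun μ : ℝ => 1 - μ • A) (𝓝 0) (𝓝 1) := by
    have : ContinuousAt (fun μ : ℝ => 1 - μ • A) 0 := by fun_prop
    simpa [ContinuousAt] using this
  exact h1.eventually (Units.isOpen.mem_nhds isUnit_one)

/-- For a controllable pair, no nonzero functional vanishes on `(1 - μ A)⁻¹ b` for all small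
negative `μ`. -/
lemma eq_zero_of_resolventVec {A : E →L[ℝ] E} {b : E} (hctrl : IsControllablePair A b)
    {w : E →L[ℝ] ℝ} (hw : ∀ᶠ μ in 𝓝[<] (0 : ℝ), w (resolventVec A b μ) = 0) : w = 0 := by
  have hlim : ∀ k : ℕ, Tendsto (fun μ => w ((A ^ k) (resolventVec A b μ))) (𝓝[<] 0)
      (𝓝 (w ((A ^ k) b))) := fun k => by
    have h0 : resolventVec A b 0 = b := by simp [resolventVec]
    have h1 := (continuousAt_resolventVec A b).tendsto.mono_left
      (nhdsWithin_le_nhds (s := Iio (0 : ℝ)))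
    rw [h0] at h1
    exact (w.continuous.tendsto _).comp (((A ^ k).continuous.tendsto _).comp h1)
  have hstep : ∀ k : ℕ, (∀ᶠ μ in 𝓝[<] (0 : ℝ), w ((A ^ k) (resolventVec A b μ)) = 0) →
      w ((A ^ k) b) = 0 := fun k hk =>
    tendsto_nhds_unique (hlim k) (tendsto_const_nhds.congr' (hk.mono fun _ h => h.symm))
  -- Two moves alternate: μ → 0 turns w A^k r(μ) = 0 into w A^k b = 0, and then r = b + μ A r leaves
  -- μ w A^{k+1} r(μ) = 0 with μ ≠ 0.
  have hall : ∀ k : ℕ, ∀ᶠ μ in 𝓝[<] (0 : ℝ), w ((A ^ k) (resolventVec A b μ)) = 0 := by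
    intro k
    induction k with
    | zero => simpa using hw
    | succ k ih =>
      filter_upwards [ih, self_mem_nhdsWithin,
        (eventually_isUnit_one_sub_smul A).filter_mono nhdsWithin_le_nhds] with μ h1 h2 h3
      rw [resolventVec_eq h3, map_add, map_add, hstep k ih, zero_add, map_smul, map_smul,
        smul_eq_mul, mul_eq_zero] at h1
      rw [pow_succ]
      exact h1.resolve_left (ne_of_lt h2)
  have hker : (⊤ : Submodule ℝ E) ≤ LinearMap.ker (w : E →ₗ[ℝ] ℝ) := by
    rw [← hctrl, Submodule.span_le]
    rintro _ ⟨k, -, rfl⟩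
    exact hstep k (hall k)
  ext v
  exact hker (Submodule.mem_top (x := v))

lemma span_image_resolventVec {A : E →L[ℝ] E} {b : E} (hctrl : IsControllablePair A b)
    {s : Set ℝ} (hs : s ∈ 𝓝[<] (0 : ℝ)) : Submodule.span ℝ (resolventVec A b '' s) = ⊤ := by
  by_contra hne
  obtain ⟨w, hw, hle⟩ := Submodule.exists_le_ker_of_lt_top _ (lt_top_iff_ne_top.2 hne)
  have h0 : LinearMap.toContinuousLinearMap w = 0 := by
    refine eq_zero_of_resolventVec hctrl ?_
    filter_upwards [hs] with μ hμ
    exact hle (Submodule.subset_span (mem_image_of_mem _ hμ))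
  apply hw
  ext v
  exact congrArg (fun T : E →L[ℝ] ℝ => T v) h0

/-- Pole placement with distinct negative eigenvalues: the eigenvectors can be chosen so that some
of them span a complement of the kernel of a given surjection. -/
theorem exists_feedback_eigenbasis {F : Type*} [AddCommGroup F] [Module ℝ F] {A : E →L[ℝ] E}
    {b : E} (hctrl : IsControllablePair A b) (π : E →ₗ[ℝ] F) (hπ : Function.Surjective π) :
    ∃ (K : E →L[ℝ] ℝ) (s : Set ℝ) (_ : Fintype s) (v : Module.Basis s ℝ E) (t : Set s),
      (∀ i : s, 1 / (i : ℝ) < 0) ∧ (∀ i : s, A (v i) - K (v i) • b = (1 / (i : ℝ)) • v i) ∧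
      ∀ z : F, ∃! x, x ∈ Submodule.span ℝ (v '' t) ∧ π x = z := by
  set Λ : Set ℝ := {μ | μ < 0 ∧ IsUnit (1 - μ • A)} with hΛ
  have hΛmem : Λ ∈ 𝓝[<] (0 : ℝ) := by
    filter_upwards [self_mem_nhdsWithin,
      (eventually_isUnit_one_sub_smul A).filter_mono nhdsWithin_le_nhds] with μ h1 h2 using ⟨h1, h2⟩
  have hspan := span_image_resolventVec hctrl hΛmem
  set r := resolventVec A b with hr
  -- The set t is chosen so that the images π(r μ) form a basis of F. Their lifts r μ are then
  -- independent and extend, within the same family, to a basis of E.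
  obtain ⟨t, htΛ, -, htspan, hti⟩ := exists_linearIndepOn_extension (K := ℝ)
    (v := fun μ => π (r μ)) (linearIndepOn_empty ℝ _) (empty_subset Λ)
  have hti' : LinearIndepOn ℝ r t := LinearIndependent.of_comp π hti
  obtain ⟨s, hsΛ, hts, hsspan, hsi⟩ := exists_linearIndepOn_extension hti' htΛ
  have hsi' : LinearIndependent ℝ (fun i : s => r i) := hsi
  have : Finite s := hsi'.finite
  let v : Module.Basis s ℝ E := Module.Basis.mk hsi' (by
    have h1 : range (fun i : s => r i) = r '' s := by rw [image_eq_range]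
    rw [h1, ← hspan]
    exact Submodule.span_le.2 hsspan)
  have hv : ∀ i, v i = r i := fun i => by simp [v]
  let _ : Fintype s := Fintype.ofFinite s
  -- The r μ form a basis, so the values of K that make all of them eigenvectors can be prescribed.
  let K : E →L[ℝ] ℝ := LinearMap.toContinuousLinearMap (v.constr ℝ fun i => -(1 / (i : ℝ)))
  have hK : ∀ i, K (v i) = -(1 / (i : ℝ)) := fun i => v.constr_basis ℝ _ i
  refine ⟨K, s, inferInstance, v, {i | (i : ℝ) ∈ t}, fun i => ?_, fun i => ?_, fun z => ?_⟩
  · exact one_div_neg.2 (hsΛ i.2).1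
  · rw [hK, hv]
    have h1 := resolventVec_eq (hsΛ i.2).2 b
    have hne : (i : ℝ) ≠ 0 := (hsΛ i.2).1.ne
    rw [← hr] at h1
    have h2 : (1 / (i : ℝ)) • r i = (1 / (i : ℝ)) • b + A (r i) := by
      conv_lhs => rw [h1]
      rw [smul_add, smul_smul, one_div_mul_cancel hne, one_smul]
    rw [h2, neg_smul]
    abel
  · have himg : v '' {i | (i : ℝ) ∈ t} = r '' t := by
      ext x
      constructor
      · rintro ⟨i, hi, rfl⟩
        exact ⟨i, hi, (hv i).symm⟩
      · rintro ⟨μ, hμ, rfl⟩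
        exact ⟨⟨μ, hts hμ⟩, hμ, hv _⟩
    rw [himg]
    have hmap : Submodule.map π (Submodule.span ℝ (r '' t)) = ⊤ := by
      rw [eq_top_iff, ← LinearMap.range_eq_top.2 hπ, ← Submodule.map_top, ← hspan,
        Submodule.map_span, Submodule.map_span, Submodule.span_le, ← image_comp, ← image_comp]
      exact htspan
    have hdisj : Disjoint (Submodule.span ℝ (r '' t)) (LinearMap.ker π) := by
      rw [image_eq_range]
      exact Submodule.range_ker_disjoint hti
    obtain ⟨x, hx, hxz⟩ := (Submodule.mem_map (f := π)).1 (hmap ▸ Submodule.mem_top (x := z))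
    refine ⟨x, ⟨hx, hxz⟩, fun y hy => ?_⟩
    have := Submodule.disjoint_def.1 hdisj (y - x) (Submodule.sub_mem _ hy.1 hx)
      (by simp [hy.2, hxz])
    exact sub_eq_zero.1 this

end PolePlacement


/-! ### The invariant subspace as a stable graph over z -/

section InvariantSubspace

variable {γ m : ℕ} {ω : FullSpace γ m → UnactuatedSpace m}

theorem exists_isStabilizedInvariantSubspace (hctrl : IsControllablePair (linA ω) (linB γ m)) :
    ∃ (K : FullSpace γ m →L[ℝ] ℝ) (S : Submodule ℝ (FullSpace γ m)),
      IsStabilizedInvariantSubspace ω K S := by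
  obtain ⟨K, s, _, v, t, hneg, heig, hgraph⟩ := exists_feedback_eigenbasis hctrl
    (LinearMap.snd ℝ (ActuatedSpace γ) (UnactuatedSpace m)) LinearMap.snd_surjective
  refine ⟨K, Submodule.span ℝ (v '' t), ?_, fun ζ hζ => ?_, ?_, fun z => ?_⟩
  · exact isExpStable_of_eigenbasis v (L := linA ω - K.smulRight (linB γ m)) hneg heig
  · have hle : Submodule.span ℝ (v '' t) ≤ (Submodule.span ℝ (v '' t)).comap
        ((linA ω - K.smulRight (linB γ m) : FullSpace γ m →L[ℝ] FullSpace γ m) :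
          FullSpace γ m →ₗ[ℝ] FullSpace γ m) := by
      rw [Submodule.span_le]
      rintro _ ⟨i, hi, rfl⟩
      have h1 : (1 / (i : ℝ)) • v i ∈ Submodule.span ℝ (v '' t) :=
        Submodule.smul_mem _ _ (Submodule.subset_span (mem_image_of_mem _ hi))
      rw [← heig i] at h1
      exact h1
    exact hle hζ
  · have hbij : Function.Bijective ((LinearMap.snd ℝ (ActuatedSpace γ) (UnactuatedSpace m)).comp
        (Submodule.span ℝ (v '' t)).subtype) := by
      constructor
      · intro x y hxy
        exact Subtype.ext ((hgraph (y : FullSpace γ m).2).unique ⟨x.2, hxy⟩ ⟨y.2, rfl⟩)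
      · intro z
        obtain ⟨x, ⟨hx, hxz⟩, -⟩ := hgraph z
        exact ⟨⟨x, hx⟩, hxz⟩
    rw [(LinearEquiv.ofBijective _ hbij).finrank_eq]
    simp
  · obtain ⟨x, ⟨hx, hxz⟩, huniq⟩ := hgraph z
    refine ⟨x.1, ?_, fun η hη => ?_⟩
    · have : x = (x.1, z) := Prod.ext rfl hxz
      exact this ▸ hx
    · exact congrArg Prod.fst (huniq (η, z) ⟨hη, rfl⟩)

variable {K : FullSpace γ m →L[ℝ] ℝ} {S : Submodule ℝ (FullSpace γ m)}

/-- An invariant subspace as in `IsStabilizedInvariantSubspace` is the graph of a linear map. -/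
lemma IsStabilizedInvariantSubspace.exists_graph (h : IsStabilizedInvariantSubspace ω K S) :
    ∃ P : UnactuatedSpace m →L[ℝ] ActuatedSpace γ, ∀ ζ, ζ ∈ S ↔ ζ.1 = P ζ.2 := by
  choose p hp huniq using h.graph
  let P : UnactuatedSpace m →ₗ[ℝ] ActuatedSpace γ :=
    { toFun := p
      map_add' := fun z w => (huniq (z + w) _ (S.add_mem (hp z) (hp w))).symm
      map_smul' := fun c z => (huniq (c • z) _ (S.smul_mem c (hp z))).symm }
  refine ⟨LinearMap.toContinuousLinearMap P, fun ζ => ⟨fun hζ => huniq ζ.2 ζ.1 hζ, fun hζ => ?_⟩⟩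
  have : ζ = (p ζ.2, ζ.2) := Prod.ext hζ rfl
  rw [this]
  exact hp ζ.2

/-- On the graph S the coordinate η₁ is a linear functional of z, and s is its Riesz representative.
-/
lemma IsStabilizedInvariantSubspace.existsUnique_output [NeZero γ]
    (h : IsStabilizedInvariantSubspace ω K S) :
    ∃! s : UnactuatedSpace m, ∀ ζ ∈ S, ζ.1 0 = inner ℝ s ζ.2 := by
  obtain ⟨P, hP⟩ := h.exists_graph
  let φ : UnactuatedSpace m →L[ℝ] ℝ := (EuclideanSpace.proj (0 : Fin γ)).comp P
  have hφ : ∀ z, inner ℝ ((InnerProductSpace.toDual ℝ (UnactuatedSpace m)).symm φ) z = P z 0 :=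
    fun z => InnerProductSpace.toDual_symm_apply
  refine ⟨(InnerProductSpace.toDual ℝ (UnactuatedSpace m)).symm φ, fun ζ hζ => ?_, fun s hs => ?_⟩
  · rw [hφ, (hP ζ).1 hζ]
  · refine ext_inner_right ℝ fun z => ?_
    rw [hφ, ← hs (P z, z) ((hP _).2 rfl)]

/-- The restriction of the linearization to the invariant subspace, in the coordinate `z`. -/
def restrictedLin (ω : FullSpace γ m → UnactuatedSpace m)
    (P : UnactuatedSpace m →L[ℝ] ActuatedSpace γ) : UnactuatedSpace m →L[ℝ] UnactuatedSpace m :=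
  ((ContinuousLinearMap.snd ℝ _ _).comp (linA ω)).comp (P.prod (ContinuousLinearMap.id ℝ _))

lemma restrictedLin_apply (P : UnactuatedSpace m →L[ℝ] ActuatedSpace γ) (z : UnactuatedSpace m) :
    restrictedLin ω P z = (linA ω (P z, z)).2 := rfl

/-- By invariance, z ↦ (Pz, z) carries solutions of the restricted system to solutions of ζ' = (A -
BK)ζ and so inherits their decay. K drops out of the z-equation because B has no z-component. -/
lemma IsStabilizedInvariantSubspace.exists_expBound (h : IsStabilizedInvariantSubspace ω K S)
    {P : UnactuatedSpace m →L[ℝ] ActuatedSpace γ} (hP : ∀ ζ, ζ ∈ S ↔ ζ.1 = P ζ.2) :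
    ∃ M > 0, ∃ lam > 0, ExpBound (restrictedLin ω P) M lam := by
  refine exists_expBound_of_isExpStable ?_
  obtain ⟨δ, hδ, M, hM, lam, hlam, H⟩ := h.stable.2
  have hle : ∀ z : UnactuatedSpace m, ‖(P z, z)‖ ≤ (‖P‖ + 1) * ‖z‖ := fun z => by
    rw [Prod.norm_mk]
    refine max_le ?_ ?_
    · have := P.le_opNorm z
      nlinarith [norm_nonneg z]
    · nlinarith [norm_nonneg z, norm_nonneg P]
  refine ⟨δ / (‖P‖ + 1), by positivity, M * (‖P‖ + 1), by positivity, lam, hlam,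
    fun T hT z hz hz0 t ht => ?_⟩
  rw [lt_div_iff₀ (by positivity), mul_comm] at hz0
  have hsol : IsSolutionOn (fun ζ => linA ω ζ - K ζ • linB γ m) univ (Ico 0 T)
      (fun t => (P (z t), z t)) := by
    intro t ht
    have hd := (hz t ht).2
    refine ⟨mem_univ _, ((P.hasFDerivAt.comp_hasDerivWithinAt t hd).prodMk hd).congr_deriv ?_⟩
    have hinv := (hP _).1 (h.invariant (P (z t), z t) ((hP _).2 rfl))
    have h2 : (linA ω (P (z t), z t) - K (P (z t), z t) • linB γ m).2
        = restrictedLin ω P (z t) := by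
      simp [restrictedLin_apply, linB, inputField]
    rw [h2] at hinv
    exact Prod.ext hinv.symm h2.symm
  calc ‖z t‖ ≤ ‖(P (z t), z t)‖ := norm_snd_le (P (z t), z t)
    _ ≤ M * Real.exp (-lam * t) * ‖(P (z 0), z 0)‖ :=
      H T hT _ hsol ((hle _).trans_lt hz0) t ht
    _ ≤ M * Real.exp (-lam * t) * ((‖P‖ + 1) * ‖z 0‖) := by gcongr; exact hle _
    _ = _ := by ring

end InvariantSubspace


/-! ### Directional derivatives of Lie derivatives -/

section LieDerivative

variable {E : Type*} [NormedAddCommGroup E] [NormedSpace ℝ E]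

lemma lieDerivIter_succ (X : E → E) (k : ℕ) (h : E → ℝ) :
    lieDerivIter X (k + 1) h = lieDeriv X (lieDerivIter X k h) :=
  Function.iterate_succ_apply' _ _ _

lemma fderiv_lieDeriv {f : E → E} {h : E → ℝ} {x : E} (hh : ContDiffAt ℝ 2 h x)
    (hf : DifferentiableAt ℝ f x) (v : E) :
    fderiv ℝ (lieDeriv f h) x v
      = fderiv ℝ (fderiv ℝ h) x v (f x) + fderiv ℝ h x (fderiv ℝ f x v) := by
  have h1 : DifferentiableAt ℝ (fderiv ℝ h) x :=
    (hh.fderiv_right (m := 1) (by norm_num)).differentiableAt (by norm_num)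
  have h2 := (h1.hasFDerivAt.clm_apply hf.hasFDerivAt).fderiv
  rw [show lieDeriv f h = fun y => fderiv ℝ h y (f y) from rfl, h2]
  simp [add_comm]

/-- If `h` has a locally constant derivative in the direction `v`, then
`L_v L_f h = L_(Df v) h`. -/
lemma fderiv_lieDeriv_of_const {f : E → E} {h : E → ℝ} {x v : E} {c : ℝ}
    (hh : ContDiffAt ℝ 2 h x) (hf : DifferentiableAt ℝ f x)
    (hv : ∀ᶠ y in 𝓝 x, fderiv ℝ h y v = c) :
    fderiv ℝ (lieDeriv f h) x v = fderiv ℝ h x (fderiv ℝ f x v) := by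
  have h1 : DifferentiableAt ℝ (fderiv ℝ h) x :=
    (hh.fderiv_right (m := 1) (by norm_num)).differentiableAt (by norm_num)
  have h2 := (hh.isSymmSndFDerivAt (by simp)).eq v (f x)
  -- After the symmetry swap, the second-order term is the derivative along f(x) of the locally
  -- constant function y ↦ Dh(y) v.
  have h3 : fderiv ℝ (fderiv ℝ h) x (f x) v = 0 := by
    have h4 : HasFDerivAt (fun y => fderiv ℝ h y v) ((fderiv ℝ (fderiv ℝ h) x).flip v) x := by
      simpa using h1.hasFDerivAt.clm_apply (hasFDerivAt_const v x)
    have h5 : HasFDerivAt (fun y => fderiv ℝ h y v) (0 : E →L[ℝ] ℝ) x :=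
      (hasFDerivAt_const c x).congr_of_eventuallyEq hv
    have := congrArg (fun T : E →L[ℝ] ℝ => T (f x)) (h4.unique h5)
    simpa using this
  rw [fderiv_lieDeriv hh hf, h2, h3, zero_add]

end LieDerivative

/-! ### Triangular structure of the iterated Lie derivatives -/

section Chain

variable {γ m : ℕ}

/-- `chainF` as a continuous linear map. -/
def chainFL (γ : ℕ) : ActuatedSpace γ →L[ℝ] ActuatedSpace γ :=
  LinearMap.toContinuousLinearMap
    { toFun := chainF γ
      map_add' := fun x y => by
        ext i
        simp only [chainF, PiLp.add_apply]
        split_ifs <;> simp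
      map_smul' := fun c x => by
        ext i
        simp only [chainF, PiLp.smul_apply, RingHom.id_apply]
        split_ifs <;> simp }

lemma chainFL_apply (η : ActuatedSpace γ) : chainFL γ η = chainF γ η := rfl

/-- The unit vector of the actuated coordinate with index `j` (zero for `γ ≤ j`). -/
def actVec (γ m j : ℕ) : FullSpace γ m := (WithLp.toLp 2 fun i => if i.val = j then 1 else 0, 0)

lemma actVec_val (i : Fin γ) : actVec γ m i = (EuclideanSpace.single i 1, 0) := by
  refine Prod.ext ?_ rfl
  ext k
  simp [actVec, Fin.ext_iff]

lemma actVec_pred [NeZero γ] : actVec γ m (γ - 1) = (chainG γ, 0) := by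
  have := NeZero.pos γ
  refine Prod.ext ?_ rfl
  ext k
  simp only [actVec, chainG]
  congr 1
  rw [eq_iff_iff]
  omega

lemma chainF_actVec {j : ℕ} (hj : j + 1 < γ) :
    chainF γ (actVec γ m (j + 1)).1 = (actVec γ m j).1 := by
  ext i
  simp only [actVec, chainF]
  split_ifs <;> first | rfl | omega

lemma eq_sum_actVec (η : ActuatedSpace γ) :
    ((η, 0) : FullSpace γ m) = ∑ i : Fin γ, η i • actVec γ m i := by
  refine Prod.ext ?_ ?_
  · ext k
    simp [Prod.fst_sum, actVec_val, Pi.single_apply]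
  · simp [Prod.snd_sum, actVec]

variable {Z : Set (UnactuatedSpace m)} {ω : FullSpace γ m → UnactuatedSpace m}

lemma driftField_eq : driftField ω = fun ζ => (chainFL γ ζ.1, ω ζ) := rfl

lemma contDiffOn_driftField {n : WithTop ℕ∞} (hω : ContDiffOn ℝ n ω (univ ×ˢ Z)) :
    ContDiffOn ℝ n (driftField ω) (univ ×ˢ Z) := by
  rw [driftField_eq]
  exact ((chainFL γ).contDiff.comp contDiff_fst).contDiffOn.prodMk hω

lemma fderiv_driftField {x : FullSpace γ m} (hx : DifferentiableAt ℝ ω x) (v : FullSpace γ m) :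
    fderiv ℝ (driftField ω) x v = (chainF γ v.1, fderiv ℝ ω x v) := by
  have h1 : HasFDerivAt (fun ζ : FullSpace γ m => chainFL γ ζ.1)
      ((chainFL γ).comp (ContinuousLinearMap.fst ℝ _ _)) x :=
    (chainFL γ).hasFDerivAt.comp x hasFDerivAt_fst
  rw [driftField_eq, (h1.prodMk hx.hasFDerivAt).fderiv]
  rfl

lemma driftField_zero (hω0 : ω 0 = 0) : driftField ω 0 = 0 :=
  Prod.ext ((chainFL γ).map_zero) hω0

variable [NeZero γ] (s : UnactuatedSpace m)

/-- `designedOutput` as a continuous linear map. -/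
def designedOutputL (γ : ℕ) [NeZero γ] (s : UnactuatedSpace m) : FullSpace γ m →L[ℝ] ℝ :=
  (EuclideanSpace.proj (0 : Fin γ)).comp (ContinuousLinearMap.fst ℝ _ _)
    - (innerSL ℝ s).comp (ContinuousLinearMap.snd ℝ _ _)

lemma designedOutput_eq : (designedOutput s : FullSpace γ m → ℝ) = designedOutputL γ s := by
  ext ζ
  simp [designedOutput, designedOutputL]

lemma designedOutputL_apply (ζ : FullSpace γ m) :
    designedOutputL γ s ζ = ζ.1 0 - inner ℝ s ζ.2 := by
  rw [← designedOutput_eq, designedOutput]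

lemma designedOutputL_actVec (j : ℕ) :
    designedOutputL γ s (actVec γ m j) = if j = 0 then 1 else 0 := by
  by_cases hj : j = 0
  · simp [designedOutputL_apply, actVec, hj]
  · simp [designedOutputL_apply, actVec, hj, Ne.symm hj]

/-- Each Lie derivative costs one order of smoothness. The class assumed for ω is just enough to
leave L_f^{γ-1} y of class C¹. -/
lemma contDiffOn_lieDerivIter (hZ : IsOpen Z)
    (hω : ContDiffOn ℝ ((max 1 (γ - 1) : ℕ) : WithTop ℕ∞) ω (univ ×ˢ Z)) (k : ℕ) :
    ∀ n : ℕ, (k = 0 ∨ n + k ≤ γ) →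
      ContDiffOn ℝ n (lieDerivIter (driftField ω) k (designedOutput s)) (univ ×ˢ Z) := by
  induction k with
  | zero =>
    intro n _
    change ContDiffOn ℝ n (designedOutput s) _
    rw [designedOutput_eq]
    exact (designedOutputL γ s).contDiff.contDiffOn
  | succ k ih =>
    intro n hn
    have hn : n + (k + 1) ≤ γ := by omega
    rw [lieDerivIter_succ]
    have h1 := (ih (n + 1) (by omega)).fderiv_of_isOpen (m := n) (isOpen_univ.prod hZ)
      (by norm_cast)
    refine h1.clm_apply ((contDiffOn_driftField hω).of_le ?_)
    exact_mod_cast (by omega : n ≤ max 1 (γ - 1))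

variable {s}

/-- Regularity assumptions on a system in actuation-decomposition form. -/
structure IsActuationForm (Z : Set (UnactuatedSpace m)) (ω : FullSpace γ m → UnactuatedSpace m) :
    Prop where
  isOpen : IsOpen Z
  zero_mem : (0 : UnactuatedSpace m) ∈ Z
  contDiffOn : ContDiffOn ℝ ((max 1 (γ - 1) : ℕ) : WithTop ℕ∞) ω (univ ×ˢ Z)
  apply_zero : ω 0 = 0
  fderiv_eq_zero : ∀ ζ ∈ (univ ×ˢ Z : Set (FullSpace γ m)), ∀ i : Fin γ, 2 ≤ i.val →
    fderiv ℝ ω ζ (EuclideanSpace.single i (1 : ℝ), 0) = 0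

namespace IsActuationForm

variable (h : IsActuationForm Z ω)

include h

omit [NeZero γ] in
lemma mem_nhds {x : FullSpace γ m} (hx : x ∈ (univ ×ˢ Z : Set (FullSpace γ m))) :
    (univ ×ˢ Z : Set (FullSpace γ m)) ∈ 𝓝 x :=
  (isOpen_univ.prod h.isOpen).mem_nhds hx

omit [NeZero γ] in
lemma zero_mem_domain : (0 : FullSpace γ m) ∈ (univ ×ˢ Z : Set (FullSpace γ m)) :=
  ⟨mem_univ _, h.zero_mem⟩

omit [NeZero γ] in
lemma contDiffOn_one : ContDiffOn ℝ 1 ω (univ ×ˢ Z) :=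
  h.contDiffOn.of_le (by exact_mod_cast le_max_left _ _)

lemma contDiffAt_one {x : FullSpace γ m} (hx : x ∈ (univ ×ˢ Z : Set (FullSpace γ m))) :
    ContDiffAt ℝ 1 ω x :=
  h.contDiffOn_one.contDiffAt (h.mem_nhds hx)

lemma differentiableAt {x : FullSpace γ m} (hx : x ∈ (univ ×ˢ Z : Set (FullSpace γ m))) :
    DifferentiableAt ℝ ω x :=
  (h.contDiffAt_one hx).differentiableAt (by norm_num)

lemma differentiableAt_driftField {x : FullSpace γ m}
    (hx : x ∈ (univ ×ˢ Z : Set (FullSpace γ m))) : DifferentiableAt ℝ (driftField ω) x :=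
  ((contDiffOn_driftField h.contDiffOn_one).contDiffAt (h.mem_nhds hx)).differentiableAt
    (by norm_num)

lemma contDiffAt_lieDerivIter (s : UnactuatedSpace m) {k n : ℕ} (hn : k = 0 ∨ n + k ≤ γ)
    {x : FullSpace γ m} (hx : x ∈ (univ ×ˢ Z : Set (FullSpace γ m))) :
    ContDiffAt ℝ n (lieDerivIter (driftField ω) k (designedOutput s)) x :=
  (contDiffOn_lieDerivIter s h.isOpen h.contDiffOn k n hn).contDiffAt (h.mem_nhds hx)

lemma linA_apply (v : FullSpace γ m) : linA ω v = (chainF γ v.1, fderiv ℝ ω 0 v) :=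
  fderiv_driftField (h.differentiableAt h.zero_mem_domain) v

/-- The drift shifts the actuated coordinates with index at least two. -/
lemma fderiv_driftField_actVec {x : FullSpace γ m} (hx : x ∈ (univ ×ˢ Z : Set (FullSpace γ m)))
    {j : ℕ} (hj : 1 ≤ j) (hjγ : j + 1 < γ) :
    fderiv ℝ (driftField ω) x (actVec γ m (j + 1)) = actVec γ m j := by
  rw [fderiv_driftField (h.differentiableAt hx), chainF_actVec hjγ]
  refine Prod.ext rfl ?_
  have := h.fderiv_eq_zero x hx ⟨j + 1, hjγ⟩ (by simpa using hj)
  rw [← actVec_val] at this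
  exact this

/-- Df shifts the coordinate vector of index i + 1 to index i when i ≥ 1. With the locally constant
derivative 0, this gives ∂_{i+1} L_f^{k+1} y = ∂_i L_f^k y, and induction descends to the output
itself. -/
lemma fderiv_lieDerivIter_actVec_of_lt (s : UnactuatedSpace m) (k : ℕ) : ∀ j, k < j → j < γ →
    ∀ x ∈ (univ ×ˢ Z : Set (FullSpace γ m)),
      fderiv ℝ (lieDerivIter (driftField ω) k (designedOutput s)) x (actVec γ m j) = 0 := by
  induction k with
  | zero =>
    intro j hj _ x _
    change fderiv ℝ (designedOutput s) x _ = 0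
    rw [designedOutput_eq, (designedOutputL γ s).fderiv, designedOutputL_actVec, if_neg hj.ne']
  | succ k ih =>
    intro j hj hjγ x hx
    obtain ⟨i, rfl⟩ : ∃ i, j = i + 1 := ⟨j - 1, by omega⟩
    rw [lieDerivIter_succ, fderiv_lieDeriv_of_const (c := 0)
      (h.contDiffAt_lieDerivIter (n := 2) s (by omega) hx) (h.differentiableAt_driftField hx),
      h.fderiv_driftField_actVec hx (by omega) hjγ]
    · exact ih i (by omega) (by omega) x hx
    · filter_upwards [h.mem_nhds hx] with y hy using ih (i + 1) (by omega) hjγ y hy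

/-- The same shift moves down the diagonal. It stops at index 1, because ω may depend on η₂. -/
lemma fderiv_lieDerivIter_actVec_self (s : UnactuatedSpace m) (k : ℕ) : k + 1 < γ →
    ∀ x ∈ (univ ×ˢ Z : Set (FullSpace γ m)),
      fderiv ℝ (lieDerivIter (driftField ω) (k + 1) (designedOutput s)) x (actVec γ m (k + 1))
        = fderiv ℝ (lieDerivIter (driftField ω) 1 (designedOutput s)) x (actVec γ m 1) := by
  induction k with
  | zero => exact fun _ _ _ => rfl
  | succ k ih =>
    intro hk x hx
    rw [lieDerivIter_succ _ (k + 1), fderiv_lieDeriv_of_const (c := 0)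
      (h.contDiffAt_lieDerivIter (n := 2) s (by omega) hx) (h.differentiableAt_driftField hx),
      h.fderiv_driftField_actVec hx (by omega) hk]
    · exact ih (by omega) x hx
    · filter_upwards [h.mem_nhds hx] with y hy using
        h.fderiv_lieDerivIter_actVec_of_lt s (k + 1) _ (by omega) hk y hy

omit h in
lemma fderiv_designedOutput_actVec_zero (s : UnactuatedSpace m) (x : FullSpace γ m) :
    fderiv ℝ (lieDerivIter (driftField ω) 0 (designedOutput s)) x (actVec γ m 0) = 1 := by
  change fderiv ℝ (designedOutput s) x _ = 1
  rw [designedOutput_eq, (designedOutputL γ s).fderiv, designedOutputL_actVec, if_pos rfl]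

end IsActuationForm

/-- The decoupling coefficient `L_g L_f^(γ-1) y`. -/
def decoupling (ω : FullSpace γ m → UnactuatedSpace m) (s : UnactuatedSpace m) :
    FullSpace γ m → ℝ :=
  lieDeriv (inputField γ m) (lieDerivIter (driftField ω) (γ - 1) (designedOutput s))

namespace IsActuationForm

lemma decoupling_eq (x : FullSpace γ m) : decoupling ω s x
    = fderiv ℝ (lieDerivIter (driftField ω) (γ - 1) (designedOutput s)) x (actVec γ m (γ - 1)) := by
  rw [actVec_pred]
  rfl

variable (h : IsActuationForm Z ω)

include h

lemma fderiv_lieDerivIter_actVec_ne_zero {k : ℕ} (hk : k < γ) {x : FullSpace γ m}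
    (hx : x ∈ (univ ×ˢ Z : Set (FullSpace γ m))) (hc : decoupling ω s x ≠ 0) :
    fderiv ℝ (lieDerivIter (driftField ω) k (designedOutput s)) x (actVec γ m k) ≠ 0 := by
  rcases Nat.eq_zero_or_pos k with rfl | hpos
  · rw [fderiv_designedOutput_actVec_zero]
    exact one_ne_zero
  · obtain ⟨i, rfl⟩ : ∃ i, k = i + 1 := ⟨k - 1, by omega⟩
    obtain ⟨j, hj⟩ : ∃ j, γ - 1 = j + 1 := ⟨γ - 2, by omega⟩
    rw [decoupling_eq, hj, h.fderiv_lieDerivIter_actVec_self s j (by omega) x hx] at hc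
    rwa [h.fderiv_lieDerivIter_actVec_self s i hk x hx]

/-- The error coordinates have an invertible derivative with respect to `η` wherever the decoupling
coefficient does not vanish. -/
lemma eq_zero_of_fderiv_lieDerivIter {x : FullSpace γ m}
    (hx : x ∈ (univ ×ˢ Z : Set (FullSpace γ m))) (hc : decoupling ω s x ≠ 0) {v : ActuatedSpace γ}
    (hv : ∀ k < γ, fderiv ℝ (lieDerivIter (driftField ω) k (designedOutput s)) x (v, 0) = 0) :
    v = 0 := by
  -- Forward substitution in a lower triangular system with nonzero diagonal.
  have key : ∀ k : ℕ, ∀ hk : k < γ, v ⟨k, hk⟩ = 0 := by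
    intro k
    induction k using Nat.strong_induction_on with
    | _ k ih =>
      intro hk
      have h1 := hv k hk
      rw [eq_sum_actVec, map_sum, Finset.sum_eq_single (⟨k, hk⟩ : Fin γ)] at h1
      · rw [map_smul, smul_eq_mul, mul_eq_zero] at h1
        exact h1.resolve_right (h.fderiv_lieDerivIter_actVec_ne_zero hk hx hc)
      · intro i _ hi
        rcases lt_or_gt_of_ne (fun e => hi (Fin.ext e) : i.val ≠ k) with hlt | hgt
        · have : v i = 0 := ih i hlt i.2
          rw [this, zero_smul, map_zero]
        · rw [map_smul, h.fderiv_lieDerivIter_actVec_of_lt s k i hgt i.2 x hx, smul_zero]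
      · simp
  ext i
  exact key i i.2

lemma lieDeriv_inputField_eq_zero (s : UnactuatedSpace m) {k : ℕ} (hk : k + 2 ≤ γ)
    {x : FullSpace γ m} (hx : x ∈ (univ ×ˢ Z : Set (FullSpace γ m))) :
    lieDeriv (inputField γ m) (lieDerivIter (driftField ω) k (designedOutput s)) x = 0 := by
  have := h.fderiv_lieDerivIter_actVec_of_lt s k (γ - 1) (by omega) (by omega) x hx
  rw [actVec_pred] at this
  exact this

/-- Since f(0) = 0, the second-order term of the product rule drops out at the origin, and each Lie
derivative only composes the differential with A. -/
lemma fderiv_lieDerivIter_zero (s : UnactuatedSpace m) (k : ℕ) : k < γ → ∀ v,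
    fderiv ℝ (lieDerivIter (driftField ω) k (designedOutput s)) 0 v
      = designedOutputL γ s ((linA ω ^ k) v) := by
  induction k with
  | zero =>
    intro _ v
    change fderiv ℝ (designedOutput s) 0 v = _
    rw [designedOutput_eq, (designedOutputL γ s).fderiv]
    rfl
  | succ k ih =>
    intro hk v
    rw [lieDerivIter_succ, fderiv_lieDeriv
      (h.contDiffAt_lieDerivIter (n := 2) s (by omega) h.zero_mem_domain)
      (h.differentiableAt_driftField h.zero_mem_domain), driftField_zero h.apply_zero, map_zero,
      zero_add, ih (by omega), pow_succ]
    rfl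

variable {K : FullSpace γ m →L[ℝ] ℝ} {S : Submodule ℝ (FullSpace γ m)}

/-- Because wA^kB = 0 for k ≤ γ - 2, one more factor A may be replaced by A - BK, which preserves S.
Hence S lies in the kernel of de at the origin. -/
lemma designedOutputL_pow_linA_eq_zero (hS : IsStabilizedInvariantSubspace ω K S)
    (hs : ∀ ζ ∈ S, ζ.1 0 = inner ℝ s ζ.2) (k : ℕ) : k < γ → ∀ ζ ∈ S,
      designedOutputL γ s ((linA ω ^ k) ζ) = 0 := by
  induction k with
  | zero =>
    intro _ ζ hζ
    rw [pow_zero, one_apply_eq_self, designedOutputL_apply, hs ζ hζ, sub_self]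
  | succ k ih =>
    intro hk ζ hζ
    have h1 := ih (by omega) _ (hS.invariant ζ hζ)
    have h2 : designedOutputL γ s ((linA ω ^ k) (linB γ m)) = 0 := by
      rw [← h.fderiv_lieDerivIter_zero s k (by omega)]
      exact h.lieDeriv_inputField_eq_zero s (by omega) h.zero_mem_domain
    rw [map_sub, map_sub, map_smul, map_smul, h2, smul_zero, sub_zero] at h1
    rw [pow_succ]
    exact h1

/-- The output has a nonvanishing decoupling coefficient at the origin: otherwise its differential
would be a left eigenvector of the linearization that annihilates the input vector. -/
lemma decoupling_zero_ne_zero (hctrl : IsControllablePair (linA ω) (linB γ m))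
    (hS : IsStabilizedInvariantSubspace ω K S) (hs : ∀ ζ ∈ S, ζ.1 0 = inner ℝ s ζ.2) :
    decoupling ω s 0 ≠ 0 := by
  intro hc
  obtain ⟨P, hP⟩ := hS.exists_graph
  set w := designedOutputL γ s with hw
  rcases Nat.lt_or_ge 1 γ with hγ | hγ
  · obtain ⟨j, hj⟩ : ∃ j, γ - 1 = j + 1 := ⟨γ - 2, by omega⟩
    rw [decoupling_eq, hj, h.fderiv_lieDerivIter_actVec_self s j (by omega) 0 h.zero_mem_domain,
      h.fderiv_lieDerivIter_zero s 1 hγ, pow_one] at hc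
    -- Indices above 1 are covered by triangularity; index 1 is the assumption that the decoupling
    -- coefficient vanishes.
    have hvanish : ∀ i : Fin γ, 0 < i.val → w (linA ω (actVec γ m i)) = 0 := by
      intro i hi
      rcases (Nat.succ_le_of_lt hi).lt_or_eq with h1 | h1
      · have := h.fderiv_lieDerivIter_actVec_of_lt s 1 i h1 i.2 0 h.zero_mem_domain
        rwa [h.fderiv_lieDerivIter_zero s 1 hγ, pow_one] at this
      · rw [← h1]; exact hc
    set lam := w (linA ω (actVec γ m 0)) with hlam
    -- The state space is the sum of S, where w and wA both vanish, and the η-directions, where only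
    -- index 0 contributes.
    have heig : ∀ ζ, w (linA ω ζ) = lam * w ζ := by
      intro ζ
      have hsplit : ζ = (P ζ.2, ζ.2) + (ζ.1 - P ζ.2, 0) := by
        refine Prod.ext ?_ ?_ <;> simp
      have hmem : ((P ζ.2, ζ.2) : FullSpace γ m) ∈ S := (hP _).2 rfl
      have h1 := h.designedOutputL_pow_linA_eq_zero hS hs 1 hγ _ hmem
      have h2 := h.designedOutputL_pow_linA_eq_zero hS hs 0 (by omega) _ hmem
      rw [pow_one] at h1
      rw [pow_zero, one_apply_eq_self] at h2
      have h3 : ∀ d : ActuatedSpace γ, w (linA ω (d, 0)) = lam * w (d, 0) := by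
        intro d
        rw [eq_sum_actVec, map_sum, map_sum, map_sum, Finset.mul_sum]
        refine Finset.sum_congr rfl fun i _ => ?_
        rw [map_smul, map_smul, map_smul, smul_eq_mul, smul_eq_mul]
        rcases Nat.eq_zero_or_pos i.val with hi | hi
        · rw [hi, ← hlam, hw, designedOutputL_actVec, if_pos rfl]
          ring
        · rw [hvanish i hi, hw, designedOutputL_actVec, if_neg hi.ne']
          ring
      rw [hsplit, map_add, map_add, map_add, h1, h2, h3, zero_add, zero_add]
    have hB : w (linB γ m) = 0 := by
      rw [hw, linB, inputField, ← actVec_pred, designedOutputL_actVec, if_neg (by omega)]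
    have hpow : ∀ k : ℕ, w ((linA ω ^ k) (linB γ m)) = 0 := by
      intro k
      induction k with
      | zero => simpa using hB
      | succ k ih =>
        rw [pow_succ']
        change w (linA ω ((linA ω ^ k) (linB γ m))) = 0
        rw [heig, ih, mul_zero]
    have hker : (⊤ : Submodule ℝ (FullSpace γ m)) ≤
        LinearMap.ker (w : FullSpace γ m →ₗ[ℝ] ℝ) := by
      rw [← hctrl, Submodule.span_le]
      rintro _ ⟨k, -, rfl⟩
      exact hpow k
    have h0 : w (actVec γ m 0) = 0 := hker Submodule.mem_top
    rw [hw, designedOutputL_actVec, if_pos rfl] at h0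
    exact one_ne_zero h0
  · have h1 : γ - 1 = 0 := by omega
    rw [decoupling_eq, h1, fderiv_designedOutput_actVec_zero] at hc
    exact one_ne_zero hc

end IsActuationForm

end Chain


/-! ### Output stabilization and transfer through charts -/

section Stabilizing

variable {E F : Type*} [NormedAddCommGroup E] [NormedSpace ℝ E] [NormedAddCommGroup F]
  [NormedSpace ℝ F]

/-- Where e is differentiable, the chain rule turns the Lie derivative of V(e) into its time
derivative along solutions, and Gronwall's inequality applies. -/
lemma IsLyapunovOutputStabilizing.isOutputStabilizing {f g : E → E} {e : E → F} {k : E → ℝ}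
    (h : IsLyapunovOutputStabilizing f g e k) (he : ∀ᶠ x in 𝓝 (0 : E), DifferentiableAt ℝ e x)
    (D : Set E) : IsOutputStabilizing f g D e k := by
  obtain ⟨V, hV, k₁, hk₁, k₂, hk₂, k₃, hk₃, hb, hle⟩ := h
  refine ⟨_, hle.and he, √(k₂ / k₁), by positivity, k₃ / 2, by positivity, fun T hT x hx => ?_⟩
  refine norm_le_of_lyapunov hk₁ hk₂ hb (fun t ht => ?_) (fun t ht => (hx t ht).1.2.1)
  exact ((hV _).comp _ (hx t ht).1.2.2).hasFDerivAt.comp_hasDerivWithinAt t (hx t ht).2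

lemma eventually_norm_le_mul {Θ : E → F} (h0 : Θ 0 = 0) (hd : DifferentiableAt ℝ Θ 0) :
    ∃ C > 0, ∀ᶠ x in 𝓝 (0 : E), ‖Θ x‖ ≤ C * ‖x‖ := by
  obtain ⟨C, hC, hb⟩ := hd.hasFDerivAt.isBigO_sub.exists_pos
  exact ⟨C, hC, by simpa [h0] using hb.bound⟩

lemma ContDiffAt.exists_nhds_lipschitzOnWith {X : E → F} {x : E} (h : ContDiffAt ℝ 1 X x) :
    ∃ L, ∃ U ∈ 𝓝 x, LipschitzOnWith L X U := by
  obtain ⟨L, U, hU, hL⟩ := h.exists_lipschitzOnWith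
  exact ⟨L, U, hU, hL⟩

/-- Existence of solutions may be checked in a chart in which the vector field is Lipschitz. -/
lemma HasExpDecay.hasGlobalSolutions_of_chart [FiniteDimensional ℝ E] {X Y : E → E} {D : Set E}
    (hdec : HasExpDecay X D) {Θ : OpenPartialHomeomorph E E} (h0 : (0 : E) ∈ Θ.source)
    (hΘ0 : Θ 0 = 0) (hΘd : DifferentiableAt ℝ Θ 0) (hsub : Θ.source ⊆ D) {T : E → E →L[ℝ] E}
    (hT : ∀ y ∈ Θ.target, HasFDerivAt Θ.symm (T y) y)
    (hXY : ∀ y ∈ Θ.target, T y (Y y) = X (Θ.symm y)) {L : NNReal} {U : Set E}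
    (hU : U ∈ 𝓝 (0 : E)) (hY : LipschitzOnWith L Y U) : HasGlobalSolutions X D := by
  obtain ⟨δ, hδ, M, hM, lam, hlam, H⟩ := hdec
  have h0t : (0 : E) ∈ Θ.target := hΘ0 ▸ Θ.map_source h0
  have hsymm0 : Θ.symm 0 = 0 := by
    conv_lhs => rw [← hΘ0]
    exact Θ.left_inv h0
  have hcont : Tendsto Θ.symm (𝓝 0) (𝓝 0) := by
    have := (hT 0 h0t).continuousAt.tendsto
    rwa [hsymm0] at this
  have hcontΘ : Tendsto Θ (𝓝 0) (𝓝 0) := by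
    have := hΘd.continuousAt.tendsto
    rwa [hΘ0] at this
  have htarget : Θ.target ∈ 𝓝 (0 : E) := Θ.open_target.mem_nhds h0t
  have hsource : Θ.source ∈ 𝓝 (0 : E) := Θ.open_source.mem_nhds h0
  have hmap : ∀ (I : Set ℝ) (y : ℝ → E), IsSolutionOn Y Θ.target I y →
      IsSolutionOn X D I (fun t => Θ.symm (y t)) := fun I y hy t ht => by
    obtain ⟨hyt, hyd⟩ := hy t ht
    refine ⟨hsub (Θ.map_target hyt), ?_⟩
    rw [← hXY _ hyt]
    exact (hT _ hyt).comp_hasDerivWithinAt t hyd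
  obtain ⟨C, hC, hCb⟩ := eventually_norm_le_mul hΘ0 hΘd
  obtain ⟨C', hC', hCb'⟩ := eventually_norm_le_mul hsymm0 (hT 0 h0t).differentiableAt
  have hev : ∀ᶠ y in 𝓝 (0 : E), ‖Θ.symm y‖ < δ ∧ ‖y‖ ≤ C * ‖Θ.symm y‖ ∧
      ‖Θ.symm y‖ ≤ C' * ‖y‖ := by
    have h1 : ∀ᶠ y in 𝓝 (0 : E), ‖Θ.symm y‖ < δ := by
      simpa using hcont.eventually (Metric.ball_mem_nhds 0 hδ)
    filter_upwards [h1, hcont.eventually hCb, hCb', htarget] with y hy1 hy2 hy3 hy4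
    exact ⟨hy1, by rwa [Θ.right_inv hy4] at hy2, hy3⟩
  obtain ⟨ρ, hρ, hball⟩ := Metric.eventually_nhds_iff_ball.1 hev
  -- Both Θ and its inverse are bounded linearly at the origin, so decay passes to the chart at the
  -- cost of a constant.
  have hYdec : HasExpDecay Y Θ.target := by
    refine hasExpDecay_of_ball (r := ρ) (M := C * M * C') (lam := lam) hρ (by positivity) hlam
      fun T' hT' y hy t ht => ?_
    have hy0 := hball _ (hy 0 ⟨le_rfl, hT'⟩).1.2
    have hyt := hball _ (hy t ht).1.2
    have h1 := H T' hT' _ (hmap _ y (hy.mono subset_rfl fun s hs => (hy s hs).1.1)) hy0.1 t ht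
    calc ‖y t‖ ≤ C * ‖Θ.symm (y t)‖ := hyt.2.1
      _ ≤ C * (M * Real.exp (-lam * t) * (C' * ‖y 0‖)) := by
        gcongr
        refine h1.trans ?_
        gcongr
        exact hy0.2.2
      _ = _ := by ring
  obtain ⟨δ', hδ', HY⟩ := hYdec.hasGlobalSolutions htarget hU hY
  have hev' : ∀ᶠ x in 𝓝 (0 : E), x ∈ Θ.source ∧ ‖Θ x‖ < δ' := by
    have h1 : ∀ᶠ x in 𝓝 (0 : E), ‖Θ x‖ < δ' := by
      simpa using hcontΘ.eventually (Metric.ball_mem_nhds 0 hδ')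
    filter_upwards [hsource, h1] with x hx1 hx2 using ⟨hx1, hx2⟩
  obtain ⟨ρ', hρ', hball'⟩ := Metric.eventually_nhds_iff_ball.1 hev'
  refine ⟨ρ', hρ', fun p hp => ?_⟩
  obtain ⟨hps, hpd⟩ := hball' p (mem_ball_zero_iff.2 hp)
  obtain ⟨y, hy0, hy⟩ := HY _ hpd
  exact ⟨fun t => Θ.symm (y t), by simp [hy0, Θ.left_inv hps], hmap _ y hy⟩

end Stabilizing

/-! ### The coordinates (e, z) and the zero dynamics -/

section ErrorChart

variable {γ m : ℕ} [NeZero γ] {Z : Set (UnactuatedSpace m)}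
  {ω : FullSpace γ m → UnactuatedSpace m} {s : UnactuatedSpace m}

/-- The coordinates `(e, z)`. -/
def errorMap (ω : FullSpace γ m → UnactuatedSpace m) (s : UnactuatedSpace m) :
    FullSpace γ m → FullSpace γ m := fun ζ => (errorCoords ω s ζ, ζ.2)

/-- A chart near the origin with coordinates `(e, z)`. -/
structure IsErrorChart (Z : Set (UnactuatedSpace m)) (ω : FullSpace γ m → UnactuatedSpace m)
    (s : UnactuatedSpace m) (Θ : OpenPartialHomeomorph (FullSpace γ m) (FullSpace γ m)) :
    Prop where
  coe : ⇑Θ = errorMap ω s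
  zero_mem : 0 ∈ Θ.source
  subset : Θ.source ⊆ univ ×ˢ Z
  decoupling_ne : ∀ x ∈ Θ.source, decoupling ω s x ≠ 0
  contDiffOn_symm : ContDiffOn ℝ 1 Θ.symm Θ.target

namespace IsActuationForm

variable (h : IsActuationForm Z ω)

include h

lemma contDiffAt_errorCoords (s : UnactuatedSpace m) {x : FullSpace γ m}
    (hx : x ∈ (univ ×ˢ Z : Set (FullSpace γ m))) : ContDiffAt ℝ 1 (errorCoords ω s) x :=
  contDiffAt_euclidean.2 fun i =>
    h.contDiffAt_lieDerivIter (n := 1) s (Or.inr (by omega)) hx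

lemma differentiableAt_errorCoords (s : UnactuatedSpace m) {x : FullSpace γ m}
    (hx : x ∈ (univ ×ˢ Z : Set (FullSpace γ m))) : DifferentiableAt ℝ (errorCoords ω s) x :=
  (h.contDiffAt_errorCoords s hx).differentiableAt (by norm_num)

lemma fderiv_errorCoords_apply (s : UnactuatedSpace m) {x : FullSpace γ m}
    (hx : x ∈ (univ ×ˢ Z : Set (FullSpace γ m))) (v : FullSpace γ m) (i : Fin γ) :
    fderiv ℝ (errorCoords ω s) x v i
      = fderiv ℝ (lieDerivIter (driftField ω) i (designedOutput s)) x v := by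
  have h1 := (EuclideanSpace.proj (𝕜 := ℝ) i).hasFDerivAt.comp x
    (h.differentiableAt_errorCoords s hx).hasFDerivAt
  exact congrArg (fun T : FullSpace γ m →L[ℝ] ℝ => T v) h1.fderiv.symm

lemma eq_zero_of_fderiv_errorCoords {x : FullSpace γ m}
    (hx : x ∈ (univ ×ˢ Z : Set (FullSpace γ m))) (hc : decoupling ω s x ≠ 0) {v : ActuatedSpace γ}
    (hv : fderiv ℝ (errorCoords ω s) x (v, 0) = 0) : v = 0 :=
  h.eq_zero_of_fderiv_lieDerivIter hx hc fun k hk => by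
    rw [← h.fderiv_errorCoords_apply s hx _ ⟨k, hk⟩, hv]
    rfl

/-- The derivative of the error coordinates along the controlled vector field. -/
lemma fderiv_errorCoords_field (s : UnactuatedSpace m) {x : FullSpace γ m}
    (hx : x ∈ (univ ×ˢ Z : Set (FullSpace γ m))) (u : ℝ) (i : Fin γ) :
    fderiv ℝ (errorCoords ω s) x (driftField ω x + u • inputField γ m x) i
      = lieDerivIter (driftField ω) (i + 1) (designedOutput s) x
        + if i.val + 1 = γ then u * decoupling ω s x else 0 := by
  rw [h.fderiv_errorCoords_apply s hx, map_add, map_smul, lieDerivIter_succ, smul_eq_mul]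
  congr 1
  split_ifs with hi
  · have : i.val = γ - 1 := by omega
    rw [this]
    rfl
  · have := h.lieDeriv_inputField_eq_zero s (k := i.val) (by omega) hx
    rw [lieDeriv] at this
    rw [this, mul_zero]

lemma errorCoords_zero (s : UnactuatedSpace m) : errorCoords ω s 0 = 0 := by
  ext i
  change lieDerivIter (driftField ω) i (designedOutput s) 0 = 0
  rcases Nat.eq_zero_or_pos i.val with hi | hi
  · rw [hi]
    change designedOutput s 0 = 0
    rw [designedOutput_eq, map_zero]
  · obtain ⟨j, hj⟩ : ∃ j, i.val = j + 1 := ⟨i.val - 1, by omega⟩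
    rw [hj, lieDerivIter_succ, lieDeriv, driftField_zero h.apply_zero, map_zero]

lemma errorMap_zero (s : UnactuatedSpace m) : errorMap ω s 0 = 0 :=
  Prod.ext (h.errorCoords_zero s) rfl

lemma hasFDerivAt_errorMap (s : UnactuatedSpace m) {x : FullSpace γ m}
    (hx : x ∈ (univ ×ˢ Z : Set (FullSpace γ m))) :
    HasFDerivAt (errorMap ω s)
      ((fderiv ℝ (errorCoords ω s) x).prod (ContinuousLinearMap.snd ℝ _ _)) x :=
  (h.differentiableAt_errorCoords s hx).hasFDerivAt.prodMk hasFDerivAt_snd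

/-- A kernel vector has zero z-part, and triangularity of de in η then kills its η-part; an
injective endomorphism in finite dimension is invertible. -/
lemma exists_equiv_errorMap {x : FullSpace γ m} (hx : x ∈ (univ ×ˢ Z : Set (FullSpace γ m)))
    (hc : decoupling ω s x ≠ 0) :
    ∃ T : FullSpace γ m ≃L[ℝ] FullSpace γ m,
      HasFDerivAt (errorMap ω s) (T : FullSpace γ m →L[ℝ] FullSpace γ m) x := by
  set T := (fderiv ℝ (errorCoords ω s) x).prod (ContinuousLinearMap.snd ℝ (ActuatedSpace γ)
    (UnactuatedSpace m)) with hT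
  have hinj : Function.Injective (T : FullSpace γ m →ₗ[ℝ] FullSpace γ m) := by
    rw [← LinearMap.ker_eq_bot, LinearMap.ker_eq_bot']
    rintro ⟨v, w⟩ hvw
    obtain rfl : w = 0 := congrArg Prod.snd hvw
    rw [h.eq_zero_of_fderiv_errorCoords hx hc (congrArg Prod.fst hvw)]
    rfl
  refine ⟨(LinearEquiv.ofInjectiveEndo _ hinj).toContinuousLinearEquiv, ?_⟩
  convert! h.hasFDerivAt_errorMap s hx

lemma continuousOn_lieDeriv_last {X : FullSpace γ m → FullSpace γ m}
    (hX : ContinuousOn X (univ ×ˢ Z)) (s : UnactuatedSpace m) :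
    ContinuousOn (lieDeriv X (lieDerivIter (driftField ω) (γ - 1) (designedOutput s)))
      (univ ×ˢ Z) := by
  have := NeZero.pos γ
  have h1 := contDiffOn_lieDerivIter s h.isOpen h.contDiffOn (γ - 1) 1 (by omega)
  exact (h1.continuousOn_fderiv_of_isOpen (isOpen_univ.prod h.isOpen) (by norm_num)).clm_apply hX

lemma continuousOn_decoupling (s : UnactuatedSpace m) :
    ContinuousOn (decoupling ω s) (univ ×ˢ Z) :=
  h.continuousOn_lieDeriv_last continuousOn_const s

lemma exists_errorChart (hc : decoupling ω s 0 ≠ 0) : ∃ Θ, IsErrorChart Z ω s Θ := by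
  obtain ⟨T, hT⟩ := h.exists_equiv_errorMap h.zero_mem_domain hc
  have hcd : ∀ x ∈ (univ ×ˢ Z : Set (FullSpace γ m)), ContDiffAt ℝ 1 (errorMap ω s) x :=
    fun x hx => (h.contDiffAt_errorCoords s hx).prodMk contDiffAt_snd
  have hopen : IsOpen ((univ ×ˢ Z : Set (FullSpace γ m)) ∩ decoupling ω s ⁻¹' {0}ᶜ) :=
    (h.continuousOn_decoupling s).isOpen_inter_preimage (isOpen_univ.prod h.isOpen)
      isOpen_compl_singleton
  -- Restricting to nonzero decoupling makes the derivative invertible on the whole source, so the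
  -- inverse is C¹ on the whole target and not only at the origin.
  let Θ := ((hcd 0 h.zero_mem_domain).toOpenPartialHomeomorph _ hT (by norm_num)).restrOpen _ hopen
  have hcoe : ⇑Θ = errorMap ω s := rfl
  have hsrc : Θ.source ⊆ (univ ×ˢ Z : Set (FullSpace γ m)) ∩ decoupling ω s ⁻¹' {0}ᶜ :=
    inter_subset_right
  refine ⟨Θ, hcoe, ⟨ContDiffAt.mem_toOpenPartialHomeomorph_source _ hT _, h.zero_mem_domain, hc⟩,
    fun x hx => (hsrc hx).1, fun x hx => (hsrc hx).2, fun y hy => ?_⟩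
  have hmem := hsrc (Θ.map_target hy)
  obtain ⟨T', hT'⟩ := h.exists_equiv_errorMap hmem.1 hmem.2
  exact (Θ.contDiffAt_symm hy hT' (hcd _ hmem.1)).contDiffWithinAt

end IsActuationForm

namespace IsErrorChart

variable {Θ : OpenPartialHomeomorph (FullSpace γ m) (FullSpace γ m)} (hΘ : IsErrorChart Z ω s Θ)

include hΘ

lemma errorCoords_symm {y : FullSpace γ m} (hy : y ∈ Θ.target) :
    errorCoords ω s (Θ.symm y) = y.1 := by
  have := Θ.right_inv hy
  rw [hΘ.coe] at this
  exact congrArg Prod.fst this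

lemma symm_snd {y : FullSpace γ m} (hy : y ∈ Θ.target) : (Θ.symm y).2 = y.2 := by
  have := Θ.right_inv hy
  rw [hΘ.coe] at this
  exact (Prod.ext_iff.1 this).2

lemma symm_errorMap {x : FullSpace γ m} (hx : x ∈ Θ.source) : Θ.symm (errorMap ω s x) = x := by
  rw [← hΘ.coe]
  exact Θ.left_inv hx

lemma source_mem_nhds : Θ.source ∈ 𝓝 (0 : FullSpace γ m) := Θ.open_source.mem_nhds hΘ.zero_mem

lemma contDiffAt_symm {y : FullSpace γ m} (hy : y ∈ Θ.target) : ContDiffAt ℝ 1 Θ.symm y :=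
  hΘ.contDiffOn_symm.contDiffAt (Θ.open_target.mem_nhds hy)

lemma differentiableAt_symm {y : FullSpace γ m} (hy : y ∈ Θ.target) :
    DifferentiableAt ℝ Θ.symm y :=
  (hΘ.contDiffAt_symm hy).differentiableAt (by norm_num)

variable (h : IsActuationForm Z ω)

include h

lemma zero_mem_target : 0 ∈ Θ.target := by
  have := Θ.map_source hΘ.zero_mem
  rwa [hΘ.coe, h.errorMap_zero] at this

lemma symm_zero : Θ.symm 0 = 0 := by
  have := hΘ.symm_errorMap hΘ.zero_mem
  rwa [h.errorMap_zero] at this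

lemma fderiv_symm_fderiv {x : FullSpace γ m} (hx : x ∈ Θ.source) (v : FullSpace γ m) :
    fderiv ℝ Θ.symm (errorMap ω s x) (fderiv ℝ (errorCoords ω s) x v, v.2) = v := by
  have hmem : errorMap ω s x ∈ Θ.target := by
    rw [← hΘ.coe]
    exact Θ.map_source hx
  have h1 := (hΘ.differentiableAt_symm hmem).hasFDerivAt.comp x
    (h.hasFDerivAt_errorMap s (hΘ.subset hx))
  have h2 : HasFDerivAt (Θ.symm ∘ errorMap ω s) (ContinuousLinearMap.id ℝ (FullSpace γ m)) x :=
    (hasFDerivAt_id x).congr_of_eventuallyEq (by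
      filter_upwards [Θ.open_source.mem_nhds hx] with y hy using hΘ.symm_errorMap hy)
  exact congrArg (fun T : FullSpace γ m →L[ℝ] FullSpace γ m => T v) (h1.unique h2)

/-- `ω` in the coordinates `(e, z)` is of class `C^1` at the origin. -/
lemma contDiffAt_comp_symm : ContDiffAt ℝ 1 (fun y => ω (Θ.symm y)) 0 := by
  have h1 : ContDiffAt ℝ 1 ω (Θ.symm 0) := by
    rw [hΘ.symm_zero h]
    exact h.contDiffAt_one h.zero_mem_domain
  exact h1.comp 0 (hΘ.contDiffAt_symm (hΘ.zero_mem_target h))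

variable {K : FullSpace γ m →L[ℝ] ℝ} {S : Submodule ℝ (FullSpace γ m)}
  (hS : IsStabilizedInvariantSubspace ω K S) (hs : ∀ ζ ∈ S, ζ.1 0 = inner ℝ s ζ.2)

include hS hs

/-- The linearized zero dynamics are the dynamics on the invariant subspace. -/
lemma fderiv_comp_symm {P : UnactuatedSpace m →L[ℝ] ActuatedSpace γ}
    (hP : ∀ ζ, ζ ∈ S ↔ ζ.1 = P ζ.2) (w : UnactuatedSpace m) :
    fderiv ℝ (fun y => ω (Θ.symm y)) 0 (0, w) = restrictedLin ω P w := by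
  have h1 : DifferentiableAt ℝ ω (Θ.symm 0) := by
    rw [hΘ.symm_zero h]
    exact h.differentiableAt h.zero_mem_domain
  have h2 := h1.hasFDerivAt.comp 0 (hΘ.differentiableAt_symm (hΘ.zero_mem_target h)).hasFDerivAt
  rw [show (fun y => ω (Θ.symm y)) = ω ∘ Θ.symm from rfl, h2.fderiv]
  -- Since (Pw, w) lies in S and de vanishes there, the derivative of the inverse chart sends (0, w)
  -- to (Pw, w).
  have h3 : fderiv ℝ (errorCoords ω s) 0 (P w, w) = 0 := by
    ext i
    rw [h.fderiv_errorCoords_apply s h.zero_mem_domain, h.fderiv_lieDerivIter_zero s i i.2,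
      h.designedOutputL_pow_linA_eq_zero hS hs i i.2 _ ((hP _).2 rfl)]
    rfl
  have h4 := hΘ.fderiv_symm_fderiv h hΘ.zero_mem (P w, w)
  rw [h3, h.errorMap_zero] at h4
  rw [ContinuousLinearMap.comp_apply, h4, restrictedLin_apply, h.linA_apply, hΘ.symm_zero h]

/-- Decay of `(e, z)` along every curve on which `e` decays. -/
lemma exists_decay {Me κ : ℝ} (hMe : 0 < Me) (hκ : 0 < κ) :
    ∃ r > 0, ∃ M' > 0, ∃ ν > 0,
      ∀ (T : ℝ) (e : ℝ → ActuatedSpace γ) (z : ℝ → UnactuatedSpace m),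
      (∀ t ∈ Ico 0 T, HasDerivWithinAt z (ω (Θ.symm (e t, z t))) (Ico 0 T) t) →
      (∀ t ∈ Ico 0 T, ‖(e t, z t)‖ < r) →
      (∀ t ∈ Ico 0 T, ‖e t‖ ≤ Me * Real.exp (-κ * t) * ‖e 0‖) →
      ∀ t ∈ Ico 0 T, ‖(e t, z t)‖ ≤ M' * Real.exp (-ν * t) * ‖(e 0, z 0)‖ := by
  obtain ⟨P, hP⟩ := hS.exists_graph
  obtain ⟨M, hM, lam, hlam, hexp⟩ := hS.exists_expBound hP
  refine hexp.exists_decay_driven hM hlam (h := fun y => ω (Θ.symm y))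
    ((hΘ.contDiffAt_comp_symm h).differentiableAt (by norm_num)).hasFDerivAt ?_
    (hΘ.fderiv_comp_symm h hS hs hP) hMe hκ
  rw [hΘ.symm_zero h, h.apply_zero]

/-- An output stabilizing feedback stabilizes the whole system near the origin. -/
theorem hasExpDecay {k : FullSpace γ m → ℝ}
    (hk : IsOutputStabilizing (driftField ω) (inputField γ m) (univ ×ˢ Z) (errorCoords ω s) k) :
    HasExpDecay (closedLoop (driftField ω) (inputField γ m) k) (univ ×ˢ Z) := by
  obtain ⟨U, hU, Me, hMe, κ, hκ, hdec⟩ := hk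
  obtain ⟨r, hr, M', hM', ν, hν, H⟩ := hΘ.exists_decay h hS hs hMe hκ
  have hd0 := (h.hasFDerivAt_errorMap s h.zero_mem_domain).differentiableAt
  have hcont : Tendsto (errorMap ω s) (𝓝 0) (𝓝 0) := by
    have := hd0.continuousAt.tendsto
    rwa [h.errorMap_zero] at this
  obtain ⟨C, hC, hCb⟩ := eventually_norm_le_mul (h.errorMap_zero s) hd0
  obtain ⟨C', hC', hCb'⟩ := eventually_norm_le_mul (hΘ.symm_zero h)
    (hΘ.differentiableAt_symm (hΘ.zero_mem_target h))
  have hev : ∀ᶠ x in 𝓝 (0 : FullSpace γ m), x ∈ U ∧ x ∈ Θ.source ∧ ‖errorMap ω s x‖ < r ∧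
      ‖errorMap ω s x‖ ≤ C * ‖x‖ ∧ ‖x‖ ≤ C' * ‖errorMap ω s x‖ := by
    have h1 : ∀ᶠ x in 𝓝 (0 : FullSpace γ m), ‖errorMap ω s x‖ < r := by
      simpa using hcont.eventually (Metric.ball_mem_nhds 0 hr)
    filter_upwards [hU, hΘ.source_mem_nhds, h1, hCb, hcont.eventually hCb'] with x h1 h2 h3 h4 h5
    rw [hΘ.symm_errorMap h2] at h5
    exact ⟨h1, h2, h3, h4, h5⟩
  obtain ⟨ρ, hρ, hball⟩ := Metric.eventually_nhds_iff_ball.1 hev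
  refine hasExpDecay_of_ball (r := ρ) (M := C' * M' * C) (lam := ν) hρ (by positivity) hν
    fun T hT x hx t ht => ?_
  have hb := fun t ht => hball _ (hx t ht).1.2
  -- The input does not act on z, so nothing about k is needed beyond the decay of e.
  have hz : ∀ t ∈ Ico 0 T, HasDerivWithinAt (fun t => (x t).2)
      (ω (Θ.symm (errorCoords ω s (x t), (x t).2))) (Ico 0 T) t := fun t ht => by
    have h1 : Θ.symm (errorCoords ω s (x t), (x t).2) = x t := hΘ.symm_errorMap (hb t ht).2.1
    have h2 := (hasFDerivAt_snd (𝕜 := ℝ) (p := x t)).comp_hasDerivWithinAt t (hx t ht).2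
    rw [h1]
    exact h2.congr_deriv (by simp [closedLoop, driftField, inputField])
  have h1 := H T (fun t => errorCoords ω s (x t)) (fun t => (x t).2) hz
    (fun t ht => (hb t ht).2.2.1)
    (hdec T hT x (hx.mono subset_rfl fun t ht => ⟨(hx t ht).1.1, (hb t ht).1⟩)) t ht
  calc ‖x t‖ ≤ C' * ‖errorMap ω s (x t)‖ := (hb t ht).2.2.2.2
    _ ≤ C' * (M' * Real.exp (-ν * t) * (C * ‖x 0‖)) := by
      gcongr
      refine h1.trans ?_
      gcongr
      exact (hb 0 ⟨le_rfl, hT⟩).2.2.2.1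
    _ = _ := by ring

/-- In the chart the zeroing manifold is e = 0, so ψ(z) is the η-part of the preimage of (0, z). -/
theorem exists_zeroDynamicsPolicy : ∃ W ψ, IsLocalZeroDynamicsPolicy Z ω s W ψ := by
  set W : Set (UnactuatedSpace m) := {z | ((0, z) : FullSpace γ m) ∈ Θ.target} with hW
  set ψ : UnactuatedSpace m → ActuatedSpace γ := fun z => (Θ.symm (0, z)).1 with hψ
  have hWopen : IsOpen W := Θ.open_target.preimage (by fun_prop)
  have h0W : (0 : UnactuatedSpace m) ∈ W := hΘ.zero_mem_target h
  have hpt : ∀ z ∈ W, Θ.symm (0, z) = (ψ z, z) := fun z hz => Prod.ext rfl (hΘ.symm_snd hz)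
  have hmem : ∀ z ∈ W, (ψ z, z) ∈ Θ.source := fun z hz => by
    rw [← hpt z hz]
    exact Θ.map_target hz
  have hzero : ∀ z ∈ W, errorCoords ω s (ψ z, z) = 0 := fun z hz => by
    rw [← hpt z hz]
    exact hΘ.errorCoords_symm hz
  have hψd : ∀ z ∈ W, ContDiffAt ℝ 1 ψ z := fun z hz => by
    have h1 : ContDiffAt ℝ 1 (fun z : UnactuatedSpace m => Θ.symm (0, z)) z :=
      (hΘ.contDiffAt_symm (y := (0, z)) hz).comp z (contDiffAt_const.prodMk contDiffAt_id)
    exact contDiffAt_fst.comp z h1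
  refine ⟨W, ψ, hWopen, h0W, fun z hz => (hΘ.subset (hmem z hz)).2,
    fun z hz => (hψd z hz).contDiffWithinAt, ?_, fun z hz => ?_, hzero, ?_, ?_, ?_⟩
  · exact congrArg Prod.fst (hΘ.symm_zero h)
  · have h1 := congrArg (fun v : ActuatedSpace γ => v 0) (hzero z hz)
    exact sub_eq_zero.1 h1
  · filter_upwards [hΘ.source_mem_nhds] with ζ hζ he
    have h1 := hΘ.symm_errorMap hζ
    rw [errorMap, he] at h1
    exact (congrArg Prod.fst h1).symm
  · rintro ⟨η, z⟩ ⟨-, hz⟩ heq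
    obtain rfl : η = ψ z := sub_eq_zero.1 heq
    have hz : z ∈ W := hz
    have hx := hmem z hz
    have hxD := hΘ.subset hx
    have hc := hΘ.decoupling_ne _ hx
    -- This input cancels L_f^γ y, the last component of e'. The other components are entries of e,
    -- already zero on the manifold.
    refine ⟨-(lieDerivIter (driftField ω) γ (designedOutput s) (ψ z, z)) / decoupling ω s (ψ z, z),
      ?_⟩
    set u := -(lieDerivIter (driftField ω) γ (designedOutput s) (ψ z, z))
      / decoupling ω s (ψ z, z) with hu
    set X := driftField ω (ψ z, z) + u • inputField γ m (ψ z, z) with hX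
    have hψ' := ((hψd z hz).differentiableAt (by norm_num)).hasFDerivAt
    have h1 : fderiv ℝ (errorCoords ω s) (ψ z, z) X = 0 := by
      ext i
      rw [hX, h.fderiv_errorCoords_field s hxD]
      split_ifs with hi
      · rw [hi, hu, div_mul_cancel₀ _ hc, add_neg_cancel]
        rfl
      · rw [add_zero]
        exact congrArg (fun v : ActuatedSpace γ => v ⟨i + 1, by omega⟩) (hzero z hz)
    have h2 : fderiv ℝ (errorCoords ω s) (ψ z, z) (fderiv ℝ ψ z X.2, X.2) = 0 := by
      have h3 := HasFDerivAt.comp z (f := fun z => (ψ z, z))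
        (h.differentiableAt_errorCoords s hxD).hasFDerivAt (hψ'.prodMk (hasFDerivAt_id z))
      have h4 : HasFDerivAt (errorCoords ω s ∘ fun z => (ψ z, z))
          (0 : UnactuatedSpace m →L[ℝ] ActuatedSpace γ) z :=
        (hasFDerivAt_const 0 z).congr_of_eventuallyEq (by
          filter_upwards [hWopen.mem_nhds hz] with w hw using hzero w hw)
      exact congrArg (fun T : UnactuatedSpace m →L[ℝ] ActuatedSpace γ => T X.2) (h3.unique h4)
    -- X and the graph tangent with the same z-part both lie in the kernel of de. Their difference
    -- has only an η-part, on which de is injective.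
    have h3 : X.1 - fderiv ℝ ψ z X.2 = 0 := by
      refine h.eq_zero_of_fderiv_errorCoords hxD hc ?_
      have h4 : ((X.1 - fderiv ℝ ψ z X.2, 0) : FullSpace γ m) = X - (fderiv ℝ ψ z X.2, X.2) :=
        Prod.ext rfl (sub_self X.2).symm
      rw [h4, map_sub, h1, h2, sub_zero]
    have h4 : HasFDerivAt (fun ζ : FullSpace γ m => ζ.1 - ψ ζ.2)
        (ContinuousLinearMap.fst ℝ _ _ - (fderiv ℝ ψ z).comp (ContinuousLinearMap.snd ℝ _ _))
        (ψ z, z) :=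
      hasFDerivAt_fst.sub (HasFDerivAt.comp (ψ z, z) (f := Prod.snd) hψ' hasFDerivAt_snd)
    rw [h4.fderiv]
    exact h3
  -- The cascade estimate is used with e = 0, so any positive constants serve for its decay.
  · obtain ⟨r, hr, M', hM', ν, hν, H⟩ := hΘ.exists_decay h hS hs one_pos one_pos
    have hdec : HasExpDecay (fun z => ω (ψ z, z)) W := by
      refine hasExpDecay_of_ball hr hM' hν fun T hT z hz t ht => ?_
      have h1 := H T (fun _ => 0) z (fun t ht => by
        rw [hpt _ (hz t ht).1.1]
        exact (hz t ht).2) (fun t ht => by simpa using (hz t ht).1.2) (by simp) t ht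
      simpa using h1
    have hcd : ContDiffAt ℝ 1 (fun z => ω (ψ z, z)) 0 := by
      have h1 : ContDiffAt ℝ 1 ω (ψ 0, 0) :=
        h.contDiffAt_one (hΘ.subset (hmem 0 h0W))
      exact ContDiffAt.comp (f := fun z => (ψ z, z)) 0 h1 ((hψd 0 h0W).prodMk contDiffAt_id)
    obtain ⟨L, U, hU, hL⟩ := hcd.exists_nhds_lipschitzOnWith
    exact ⟨hdec.hasGlobalSolutions (hWopen.mem_nhds h0W) hU hL, hdec⟩

end IsErrorChart

end ErrorChart


/-! ### The feedback that linearizes the error dynamics -/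

section Linearizing

variable {γ m : ℕ} [NeZero γ] {Z : Set (UnactuatedSpace m)}
  {ω : FullSpace γ m → UnactuatedSpace m} {s : UnactuatedSpace m}

omit [NeZero γ] in
/-- The chain of integrators is controllable. -/
lemma isControllablePair_chain : IsControllablePair (chainFL γ) (chainG γ) := by
  rcases Nat.eq_zero_or_pos γ with rfl | hγ
  · exact Subsingleton.elim _ _
  have : NeZero γ := ⟨hγ.ne'⟩
  -- The controllability matrix consists of the unit vectors in reverse order.
  have hpow : ∀ k j, j + k + 1 = γ → (chainFL γ ^ k) (chainG γ) = (actVec γ 0 j).1 := by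
    intro k
    induction k with
    | zero =>
      intro j hj
      have h1 : j = γ - 1 := by omega
      rw [h1, actVec_pred]
      rfl
    | succ k ih =>
      intro j hj
      rw [pow_succ']
      change chainFL γ ((chainFL γ ^ k) (chainG γ)) = _
      rw [ih (j + 1) (by omega), chainFL_apply, chainF_actVec (by omega)]
  rw [IsControllablePair, eq_top_iff]
  rintro v -
  have hv : v = ∑ i : Fin γ, v i • (actVec γ 0 i).1 := by
    have h1 := congrArg Prod.fst (eq_sum_actVec (m := 0) v)
    simpa [Prod.fst_sum] using h1
  rw [hv]
  refine Submodule.sum_mem _ fun i _ => Submodule.smul_mem _ _ (Submodule.subset_span ?_)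
  exact ⟨γ - 1 - i, by rw [finrank_euclideanSpace_fin]; omega, (hpow _ i (by omega)).symm⟩

/-- The feedback that makes the error dynamics linear: `e' = F e - G Kₑ e`. -/
def linearizingFeedback (ω : FullSpace γ m → UnactuatedSpace m) (s : UnactuatedSpace m)
    (Ke : ActuatedSpace γ →L[ℝ] ℝ) : FullSpace γ m → ℝ := fun ζ =>
  (-lieDerivIter (driftField ω) γ (designedOutput s) ζ - Ke (errorCoords ω s ζ))
    / decoupling ω s ζ

namespace IsActuationForm

variable (h : IsActuationForm Z ω) (Ke : ActuatedSpace γ →L[ℝ] ℝ)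

include h

lemma fderiv_errorCoords_linearizing {x : FullSpace γ m}
    (hx : x ∈ (univ ×ˢ Z : Set (FullSpace γ m))) (hc : decoupling ω s x ≠ 0) :
    fderiv ℝ (errorCoords ω s) x
      (closedLoop (driftField ω) (inputField γ m) (linearizingFeedback ω s Ke) x)
      = (chainFL γ - Ke.smulRight (chainG γ)) (errorCoords ω s x) := by
  ext i
  rw [closedLoop, h.fderiv_errorCoords_field s hx, linearizingFeedback, div_mul_cancel₀ _ hc]
  simp only [sub_apply, ContinuousLinearMap.smulRight_apply, chainFL_apply,
    PiLp.sub_apply, PiLp.smul_apply, chainF, chainG, smul_eq_mul]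
  by_cases hi : i.val + 1 = γ
  · rw [if_pos hi, if_pos hi, dif_neg (by omega), hi]
    ring
  · rw [if_neg hi, if_neg hi, dif_pos (by omega), mul_zero, add_zero, sub_zero]
    rfl

omit h in
lemma lieDerivIter_gamma_eq (s : UnactuatedSpace m) :
    lieDerivIter (driftField ω) γ (designedOutput s)
      = lieDeriv (driftField ω) (lieDerivIter (driftField ω) (γ - 1) (designedOutput s)) := by
  have := NeZero.pos γ
  rw [← lieDerivIter_succ, Nat.sub_add_cancel this]

lemma linearizingFeedback_zero : linearizingFeedback ω s Ke 0 = 0 := by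
  rw [linearizingFeedback, h.errorCoords_zero, lieDerivIter_gamma_eq, lieDeriv,
    driftField_zero h.apply_zero, map_zero, map_zero, neg_zero, sub_zero, zero_div]

lemma continuousAt_linearizingFeedback {x : FullSpace γ m}
    (hx : x ∈ (univ ×ˢ Z : Set (FullSpace γ m))) (hc : decoupling ω s x ≠ 0) :
    ContinuousAt (linearizingFeedback ω s Ke) x := by
  have h1 := (h.continuousOn_lieDeriv_last
    (contDiffOn_driftField h.contDiffOn_one).continuousOn s).continuousAt (h.mem_nhds hx)
  rw [← lieDerivIter_gamma_eq] at h1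
  have h2 := (h.contDiffAt_errorCoords s hx).continuousAt
  have h3 := (h.continuousOn_decoupling s).continuousAt (h.mem_nhds hx)
  exact (h1.neg.sub (Ke.continuous.continuousAt.comp h2)).div h3 hc

end IsActuationForm

namespace IsErrorChart

variable {Θ : OpenPartialHomeomorph (FullSpace γ m) (FullSpace γ m)} (hΘ : IsErrorChart Z ω s Θ)
  (h : IsActuationForm Z ω)

include hΘ h

/-- Picard–Lindelöf need not apply in ζ, since L_f^γ y is only known to be continuous. In the chart
the closed loop is e' = (F - GKₑ)e, z' = ω(Θ⁻¹(e, z)), which is C¹ at the origin. -/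
lemma hasGlobalSolutions_linearizing (Ke : ActuatedSpace γ →L[ℝ] ℝ)
    (hdec : HasExpDecay (closedLoop (driftField ω) (inputField γ m) (linearizingFeedback ω s Ke))
      (univ ×ˢ Z)) :
    HasGlobalSolutions (closedLoop (driftField ω) (inputField γ m) (linearizingFeedback ω s Ke))
      (univ ×ˢ Z) := by
  set Le := chainFL γ - Ke.smulRight (chainG γ) with hLe
  have hY : ContDiffAt ℝ 1 (fun y : FullSpace γ m => (Le y.1, ω (Θ.symm y))) 0 :=
    (Le.contDiff.comp contDiff_fst).contDiffAt.prodMk (hΘ.contDiffAt_comp_symm h)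
  obtain ⟨L, U, hU, hL⟩ := hY.exists_nhds_lipschitzOnWith
  refine hdec.hasGlobalSolutions_of_chart hΘ.zero_mem ?_ ?_ hΘ.subset
    (fun y hy => (hΘ.differentiableAt_symm hy).hasFDerivAt) (fun y hy => ?_) hU hL
  · rw [hΘ.coe, h.errorMap_zero]
  · rw [hΘ.coe]
    exact (h.hasFDerivAt_errorMap s h.zero_mem_domain).differentiableAt
  · have hx := Θ.map_target hy
    have h1 := hΘ.fderiv_symm_fderiv h hx
      (closedLoop (driftField ω) (inputField γ m) (linearizingFeedback ω s Ke) (Θ.symm y))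
    rw [h.fderiv_errorCoords_linearizing Ke (hΘ.subset hx) (hΘ.decoupling_ne _ hx),
      hΘ.errorCoords_symm hy, ← hΘ.coe, Θ.right_inv hy] at h1
    rw [← h1]
    congr 2
    simp [closedLoop, driftField, inputField]

variable {K : FullSpace γ m →L[ℝ] ℝ} {S : Submodule ℝ (FullSpace γ m)}
  (hS : IsStabilizedInvariantSubspace ω K S) (hs : ∀ ζ ∈ S, ζ.1 0 = inner ℝ s ζ.2)

include hS hs

lemma hasExpDecay_of_stabilizing {k : FullSpace γ m → ℝ}
    (hk : IsLyapunovOutputStabilizing (driftField ω) (inputField γ m) (errorCoords ω s) k ∨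
      IsOutputStabilizing (driftField ω) (inputField γ m) (univ ×ˢ Z) (errorCoords ω s) k) :
    HasExpDecay (closedLoop (driftField ω) (inputField γ m) k) (univ ×ˢ Z) := by
  refine hΘ.hasExpDecay h hS hs (hk.elim (fun hk => ?_) id)
  refine hk.isOutputStabilizing ?_ _
  filter_upwards [h.mem_nhds h.zero_mem_domain] with x hx using h.differentiableAt_errorCoords s hx

theorem exists_stabilizing_feedback :
    ∃ k : FullSpace γ m → ℝ, k 0 = 0 ∧ (∀ᶠ ζ in 𝓝 (0 : FullSpace γ m), ContinuousAt k ζ) ∧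
      IsLyapunovOutputStabilizing (driftField ω) (inputField γ m) (errorCoords ω s) k ∧
      IsExpStable (closedLoop (driftField ω) (inputField γ m) k) (univ ×ˢ Z) := by
  -- Only the eigenbasis is needed for the integrator chain, so the surjection is taken onto a
  -- point.
  obtain ⟨Ke, ι, _, v, -, hneg, heig, -⟩ := exists_feedback_eigenbasis
    (isControllablePair_chain (γ := γ)) (0 : ActuatedSpace γ →ₗ[ℝ] PUnit)
    (fun _ => ⟨0, Subsingleton.elim _ _⟩)
  obtain ⟨V, hV, k₁, hk₁, k₂, hk₂, k₃, hk₃, hb, hle⟩ := exists_lyapunov_of_eigenbasis v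
    (L := chainFL γ - Ke.smulRight (chainG γ)) hneg heig
  have hlyap : IsLyapunovOutputStabilizing (driftField ω) (inputField γ m) (errorCoords ω s)
      (linearizingFeedback ω s Ke) := by
    refine ⟨V, hV, k₁, hk₁, k₂, hk₂, k₃, hk₃, hb, ?_⟩
    filter_upwards [hΘ.source_mem_nhds] with x hx
    have h1 := (hV (errorCoords ω s x)).hasFDerivAt.comp x
      (h.differentiableAt_errorCoords s (hΘ.subset hx)).hasFDerivAt
    have h2 : lieDeriv (closedLoop (driftField ω) (inputField γ m) (linearizingFeedback ω s Ke))
        (fun x' => V (errorCoords ω s x')) x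
        = fderiv ℝ V (errorCoords ω s x) (fderiv ℝ (errorCoords ω s) x
          (closedLoop (driftField ω) (inputField γ m) (linearizingFeedback ω s Ke) x)) :=
      congrArg (fun T : FullSpace γ m →L[ℝ] ℝ =>
        T (closedLoop (driftField ω) (inputField γ m) (linearizingFeedback ω s Ke) x)) h1.fderiv
    rw [h2, h.fderiv_errorCoords_linearizing Ke (hΘ.subset hx) (hΘ.decoupling_ne x hx)]
    exact hle _
  have hdec := hΘ.hasExpDecay_of_stabilizing h hS hs (Or.inl hlyap)
  refine ⟨linearizingFeedback ω s Ke, h.linearizingFeedback_zero Ke, ?_, hlyap,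
    hΘ.hasGlobalSolutions_linearizing h Ke hdec, hdec⟩
  filter_upwards [hΘ.source_mem_nhds] with x hx using
    h.continuousAt_linearizingFeedback Ke (hΘ.subset hx) (hΘ.decoupling_ne x hx)

end IsErrorChart

lemma IsActuationForm.exists_lipschitzOnWith_closedLoop (h : IsActuationForm Z ω)
    {k : FullSpace γ m → ℝ} (hk : ∃ L, ∃ U ∈ 𝓝 (0 : FullSpace γ m), LipschitzOnWith L k U) :
    ∃ L, ∃ U ∈ 𝓝 (0 : FullSpace γ m),
      LipschitzOnWith L (closedLoop (driftField ω) (inputField γ m) k) U := by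
  obtain ⟨L, U, hU, hL⟩ := hk
  have h1 : ContDiffAt ℝ 1 (driftField ω) 0 :=
    (contDiffOn_driftField h.contDiffOn_one).contDiffAt (h.mem_nhds h.zero_mem_domain)
  obtain ⟨L', U', hU', hL'⟩ := h1.exists_nhds_lipschitzOnWith
  let T : ℝ →L[ℝ] FullSpace γ m := (ContinuousLinearMap.id ℝ ℝ).smulRight (inputField γ m 0)
  exact ⟨_, U' ∩ U, inter_mem hU' hU, (hL'.mono inter_subset_left).add
    (T.lipschitz.comp_lipschitzOnWith (hL.mono inter_subset_right))⟩

end Linearizing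

end

/-! ### The main theorem -/

theorem mainTheorem2 (γ m : ℕ) [NeZero γ]
    (Z : Set (UnactuatedSpace m)) (hZ : IsOpen Z) (hZ0 : (0 : UnactuatedSpace m) ∈ Z)
    (ω : FullSpace γ m → UnactuatedSpace m)
    (hω : ContDiffOn ℝ ((max 1 (γ - 1) : ℕ) : WithTop ℕ∞) ω (univ ×ˢ Z))
    (hω0 : ω 0 = 0)
    (hω3 : ∀ ζ ∈ (univ ×ˢ Z : Set (FullSpace γ m)), ∀ i : Fin γ, 2 ≤ i.val →
      fderiv ℝ ω ζ (EuclideanSpace.single i (1 : ℝ), 0) = 0)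
    (hctrl : IsControllablePair (linA ω) (linB γ m)) :
    (∃ (K : FullSpace γ m →L[ℝ] ℝ) (S : Submodule ℝ (FullSpace γ m)),
      IsStabilizedInvariantSubspace ω K S) ∧
    ∀ (K : FullSpace γ m →L[ℝ] ℝ) (S : Submodule ℝ (FullSpace γ m)),
      IsStabilizedInvariantSubspace ω K S →
      (∃! s : UnactuatedSpace m, ∀ ζ ∈ S, ζ.1 0 = inner ℝ s ζ.2) ∧
      ∀ s : UnactuatedSpace m, (∀ ζ ∈ S, ζ.1 0 = inner ℝ s ζ.2) →
        (∀ᶠ ζ₀ in 𝓝 (0 : FullSpace γ m),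
          HasRelativeDegreeAt (driftField ω) (inputField γ m) (univ ×ˢ Z)
            (designedOutput s) γ ζ₀) ∧
        (∃ (W : Set (UnactuatedSpace m)) (ψ : UnactuatedSpace m → ActuatedSpace γ),
          IsLocalZeroDynamicsPolicy Z ω s W ψ) ∧
        (∃ k : FullSpace γ m → ℝ, k 0 = 0 ∧ (∀ᶠ ζ in 𝓝 (0 : FullSpace γ m), ContinuousAt k ζ) ∧
          IsLyapunovOutputStabilizing (driftField ω) (inputField γ m) (errorCoords ω s) k ∧
          IsExpStable (closedLoop (driftField ω) (inputField γ m) k) (univ ×ˢ Z)) ∧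
        ∀ k : FullSpace γ m → ℝ,
          (IsLyapunovOutputStabilizing (driftField ω) (inputField γ m) (errorCoords ω s) k ∨
            IsOutputStabilizing (driftField ω) (inputField γ m) (univ ×ˢ Z)
              (errorCoords ω s) k) →
          HasExpDecay (closedLoop (driftField ω) (inputField γ m) k) (univ ×ˢ Z) ∧
          ((∃ L, ∃ U ∈ 𝓝 (0 : FullSpace γ m), LipschitzOnWith L k U) →
            HasGlobalSolutions (closedLoop (driftField ω) (inputField γ m) k) (univ ×ˢ Z)) := by
  have h : IsActuationForm Z ω := ⟨hZ, hZ0, hω, hω0, hω3⟩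
  refine ⟨exists_isStabilizedInvariantSubspace hctrl, fun K S hS =>
    ⟨hS.existsUnique_output, fun s hs => ?_⟩⟩
  obtain ⟨Θ, hΘ⟩ := h.exists_errorChart (h.decoupling_zero_ne_zero hctrl hS hs)
  refine ⟨?_, hΘ.exists_zeroDynamicsPolicy h hS hs, hΘ.exists_stabilizing_feedback h hS hs,
    fun k hk => ?_⟩
  · filter_upwards [hΘ.source_mem_nhds] with x hx
    exact ⟨NeZero.one_le, fun k hk y hy => h.lieDeriv_inputField_eq_zero s hk hy,
      hΘ.decoupling_ne x hx⟩
  · have hdec := hΘ.hasExpDecay_of_stabilizing h hS hs hk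
    refine ⟨hdec, fun hLip => ?_⟩
    obtain ⟨L, U, hU, hL⟩ := h.exists_lipschitzOnWith_closedLoop hLip
    exact hdec.hasGlobalSolutions (h.mem_nhds h.zero_mem_domain) hU hL
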